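/- There is an oracle $\mathcal V\subseteq\{0,1\}^*$ such that the following three statements hold. 1. Relative to $\mathcal V$ there is no complete disjoint $\mathsf{coNP}$ pair. Here a disjoint $\mathsf{coNP}^{\mathcal V}$ pair is a pair $(A_0,A_1)$ of languages in $\mathsf{coNP}^{\mathcal V}$ with $A_0\cap A_1=\varnothing$; such a pair $(A_0,A_1)$ is reducible to such a pair $(B_0,B_1)$ if there is a function $f\in\mathsf{FP}^{\mathcal V}$ (computable in deterministic polynomial time with oracle $\mathcal V$) such that $x\in A_i$ implies $f(x)\in B_i$ for all words $x$ and $i\in\{0,1\}$; and a disjoint $\mathsf{coNP}^{\mathcal V}$ pair is complete if every disjoint $\mathsf{coNP}^{\mathcal V}$ pair is reducible to it. 2. $\mathsf{E}^{\mathcal V}=\mathsf{NE}^{\mathcal V}$, where $\mathsf{E}^{\mathcal V}$ and $\mathsf{NE}^{\mathcal V}$ are the classes of languages decided by deterministic, respectively accepted by nondeterministic, oracle machines with oracle $\mathcal V$ in time $2^{O(n)}$. 3. There is a p-optimal proof system for $\mathsf{TAUT}^{\mathcal V}$ relative to $\mathcal V$. Here $\mathsf{TAUT}^{\mathcal V}$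 is the set of (codes of) tautologies among the propositional formulas that may contain, besides the usual connectives, oracle gates $\alpha(\varphi_1,\dots,\varphi_n)$, which are true under an assignment iff the word formed by the truth values of $\varphi_1,\dots,\varphi_n$ belongs to $\mathcal V$. A proof system for a set $C\subseteq\{0,1\}^*$ relative to $\mathcal V$ is a function $P\in\mathsf{FP}^{\mathcal V}$ with range $C$; it is p-optimal if for every proof system $Q$ for $C$ relative to $\mathcal V$ there is $f\in\mathsf{FP}^{\mathcal V}$ with $P(f(\pi))=Q(\pi)$ for all words $\pi$. -/

import Mathlib

namespace OracleWorld

/-! ### Oracle machines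

Words are lists of bits; a natural number with binary expansion `1x` is identified with the word `x`.
The machine model is the multi-stack machine with a finite control (the model that Mathlib uses for
polynomial time, where a Turing machine tape is a pair of stacks and a stack is half a tape, so that
running times agree with those of multi-tape Turing machines up to a constant factor), extended with
oracle queries and with binary nondeterministic guesses.  -/

/-- Instructions.  Labels (the states of the finite control) and stacks are numbered. -/
inductive Instr : Type
  /-- push the bit `b` on stack `k`, go to `next` -/
  | push (k : ℕ) (b : Bool) (next : ℕ)
  /-- if stack `k` is empty go to `ifEmpty`, otherwise remove its top bit and go to `ifFalse` or
  to `ifTrue` according to the removed bit -/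
  | pop (k : ℕ) (ifEmpty ifFalse ifTrue : ℕ)
  /-- ask the oracle about the word on the query stack -/
  | query (ifYes ifNo : ℕ)
  /-- guess a bit nondeterministically -/
  | guess (ifFalse ifTrue : ℕ)

/-- A program is a finite list of instructions, labelled by their positions.  Every label at which
there is no instruction is a halting label. A program mentions only finitely many stacks. -/
abbrev Program : Type := List Instr

/-- A configuration: the current label and the contents of the stacks (top first). -/
structure Config : Type where
  pc : ℕ
  stk : ℕ → List Bool

/-- The stack that holds the input at the start. -/
abbrev inputStack : ℕ := 0
/-- The stack that holds the output at the end. -/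
abbrev outputStack : ℕ := 1
/-- The stack whose content is the word asked in an oracle query. -/
abbrev queryStack : ℕ := 2

/-- Start at label `0` with the input on the input stack and all other stacks empty. -/
def Config.init (x : List Bool) : Config where
  pc := 0
  stk := Function.update (fun _ => []) inputStack x

open Classical in
/-- The effect of one instruction, with oracle `V`; `b` is the guessed bit, should the instruction
be a guess. -/
noncomputable def Instr.exec (V : Set (List Bool)) (b : Bool) (c : Config) : Instr → Config
  | .push k a next => ⟨next, Function.update c.stk k (a :: c.stk k)⟩
  | .pop k ifEmpty ifFalse ifTrue =>
    match c.stk k with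
    | [] => ⟨ifEmpty, c.stk⟩
    | false :: w => ⟨ifFalse, Function.update c.stk k w⟩
    | true :: w => ⟨ifTrue, Function.update c.stk k w⟩
  | .query ifYes ifNo => ⟨if c.stk queryStack ∈ V then ifYes else ifNo, c.stk⟩
  | .guess ifFalse ifTrue => ⟨if b = true then ifTrue else ifFalse, c.stk⟩

/-- One step of the machine; halted configurations do not change. -/
noncomputable def Program.step (p : Program) (V : Set (List Bool)) (b : Bool) (c : Config) :
    Config :=
  match p[c.pc]? with
  | none => c
  | some i => i.exec V b c

/-- The configuration after `t` steps on input `x`, on the computation path given by the guesses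
`g`. -/
noncomputable def Program.run (p : Program) (V : Set (List Bool)) (g : ℕ → Bool) (x : List Bool) :
    ℕ → Config
  | 0 => Config.init x
  | t + 1 => p.step V (g t) (p.run V g x t)

/-- On input `x` and the computation path given by `g`, the machine with oracle `V` halts within `T`
steps, with output `y`. -/
def Program.Outputs (p : Program) (V : Set (List Bool)) (g : ℕ → Bool) (x : List Bool) (T : ℕ)
    (y : List Bool) : Prop :=
  p[(p.run V g x T).pc]? = none ∧ (p.run V g x T).stk outputStack = y

/-- A deterministic program has no guess instruction (so the guesses `g` play no role in its
runs). -/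
def Program.IsDeterministic (p : Program) : Prop :=
  ∀ l l' : ℕ, Instr.guess l l' ∉ p

/-! ### Complexity classes relative to an oracle `V` -/

/-- Languages decided by a deterministic machine with oracle `V` in time `T`. -/
def DTIME (V : Set (List Bool)) (T : ℕ → ℕ) : Set (Set (List Bool)) :=
  {L | ∃ p : Program, p.IsDeterministic ∧ ∀ x : List Bool, ∃ b : Bool, (b = true ↔ x ∈ L) ∧
    p.Outputs V (fun _ => false) x (T x.length) [b]}

/-- Languages accepted by a nondeterministic machine with oracle `V` in time `T`: a word is in the
language iff some computation path of at most that length accepts it (halts with output `1`). -/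
def NTIME (V : Set (List Bool)) (T : ℕ → ℕ) : Set (Set (List Bool)) :=
  {L | ∃ p : Program, ∀ x : List Bool, x ∈ L ↔
    ∃ g : ℕ → Bool, p.Outputs V g x (T x.length) [true]}

/-- Deterministic time `2 ^ O(n)`. -/
def E (V : Set (List Bool)) : Set (Set (List Bool)) :=
  {L | ∃ c : ℕ, L ∈ DTIME V (fun n => 2 ^ (c * n + c))}

/-- Nondeterministic time `2 ^ O(n)`. -/
def NE (V : Set (List Bool)) : Set (Set (List Bool)) :=
  {L | ∃ c : ℕ, L ∈ NTIME V (fun n => 2 ^ (c * n + c))}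

/-- Nondeterministic polynomial time. -/
def NP (V : Set (List Bool)) : Set (Set (List Bool)) :=
  {L | ∃ c : ℕ, L ∈ NTIME V (fun n => n ^ c + c)}

/-- Complements of languages in `NP`. -/
def CoNP (V : Set (List Bool)) : Set (Set (List Bool)) :=
  {L | Lᶜ ∈ NP V}

/-- Functions computable in deterministic polynomial time. -/
def FP (V : Set (List Bool)) : Set (List Bool → List Bool) :=
  {f | ∃ p : Program, p.IsDeterministic ∧ ∃ c : ℕ, ∀ x : List Bool,
    p.Outputs V (fun _ => false) x (x.length ^ c + c) (f x)}

/-! ### Disjoint coNP pairs -/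

/-- Disjoint pairs of `coNP` languages, relative to `V`. -/
def DisjCoNP (V : Set (List Bool)) : Set (Set (List Bool) × Set (List Bool)) :=
  {A | A.1 ∈ CoNP V ∧ A.2 ∈ CoNP V ∧ Disjoint A.1 A.2}

/-- The pair `A` is polynomially reducible to the pair `B`, relative to `V`. -/
def PairReducible (V : Set (List Bool)) (A B : Set (List Bool) × Set (List Bool)) : Prop :=
  ∃ f ∈ FP V, ∀ x : List Bool, (x ∈ A.1 → f x ∈ B.1) ∧ (x ∈ A.2 → f x ∈ B.2)

/-- `B` is complete for the class of disjoint `coNP` pairs, relative to `V`. -/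
def IsCompleteDisjCoNP (V : Set (List Bool)) (B : Set (List Bool) × Set (List Bool)) : Prop :=
  B ∈ DisjCoNP V ∧ ∀ A ∈ DisjCoNP V, PairReducible V A B

/-! ### Tautologies and proof systems -/

/-- Propositional formulas with oracle gates: besides the usual connectives there is, for each `n`,
an `n`-ary connective that stands for membership of the word of its arguments in the oracle. -/
inductive Formula : Type
  | const (b : Bool)
  | var (i : ℕ)
  | neg (φ : Formula)
  | and (φ ψ : Formula)
  | or (φ ψ : Formula)
  | oracle (n : ℕ) (φ : Fin n → Formula)

open Classical in
/-- Truth value of a formula under the assignment `v`, relative to the oracle `V`. -/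
noncomputable def Formula.eval (V : Set (List Bool)) (v : ℕ → Bool) : Formula → Bool
  | .const b => b
  | .var i => v i
  | .neg φ => !(φ.eval V v)
  | .and φ ψ => φ.eval V v && ψ.eval V v
  | .or φ ψ => φ.eval V v || ψ.eval V v
  | .oracle _ φ => decide ((List.ofFn fun i => (φ i).eval V v) ∈ V)

/-- Self-delimiting code of a number: double the bits of its binary expansion and append `01`. -/
def encodeNat (n : ℕ) : List Bool :=
  (Nat.bits n).flatMap (fun b => [b, b]) ++ [false, true]

/-- Code of a formula as a word, in prefix notation. -/
def Formula.encode : Formula → List Bool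
  | .const b => [false, false, b]
  | .var i => [false, true, false] ++ encodeNat i
  | .neg φ => [false, true, true] ++ φ.encode
  | .and φ ψ => [true, false, false] ++ φ.encode ++ ψ.encode
  | .or φ ψ => [true, false, true] ++ φ.encode ++ ψ.encode
  | .oracle n φ =>
    [true, true, false] ++ encodeNat n ++ (List.ofFn fun i => (φ i).encode).flatten

/-- The codes of the propositional tautologies relative to `V`. -/
def TAUT (V : Set (List Bool)) : Set (List Bool) :=
  {w | ∃ φ : Formula, φ.encode = w ∧ ∀ v : ℕ → Bool, φ.eval V v = true}

/-- Proof systems for `C` relative to `V`: polynomial time functions with range `C`. -/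
def IsProofSystem (V C : Set (List Bool)) (P : List Bool → List Bool) : Prop :=
  P ∈ FP V ∧ Set.range P = C

/-- `P` p-simulates `Q`, relative to `V`: there is a polynomial time function that translates
`Q`-proofs into `P`-proofs of the same word. -/
def PSimulates (V : Set (List Bool)) (P Q : List Bool → List Bool) : Prop :=
  ∃ f ∈ FP V, ∀ x : List Bool, P (f x) = Q x

/-- `P` is a p-optimal proof system for `C`, relative to `V`. -/
def IsPOptimal (V C : Set (List Bool)) (P : List Bool → List Bool) : Prop :=
  IsProofSystem V C P ∧ ∀ Q, IsProofSystem V C Q → PSimulates V P Q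

end OracleWorld

/-!
The oracle is built so that it does most of the computing itself. A set `G` of generic words is
left free, and membership of all other words in `oracleOf G` is fixed by recursion on their length.
The word `1ᴺ` states that a nondeterministic program accepts an input within a time bound, or that
a program outputs a non-tautology within a time bound on some input; the programs, inputs and time
bounds are parts of `N`, and a run of `T ≤ N` steps only asks about words shorter than `T`. Further
words give the output bits of a few functions, so that one program, `bitProgram`, computes all of
them.

There is only one coding word of each length. Nondeterministic exponential time can therefore be
decided by asking one coding word of exponential length, whence `E = NE` (`NE_subset_E`), while
polynomial time machines get only polynomially much help. The coding words also tell in polynomial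
time whether a program is sound for inputs on which it halts within `T` steps. So a proof in
`proofSystem` may consist of a program, a padded time bound `T` and an input: it proves the output
of the program, if this program is sound at `T`. Every other proof system is simulated by naming
its program, which gives p-optimality (`isPOptimal_proofSystem`).

For the disjoint pairs, the sides of the pair number `j` consist of the inputs `x` without a witness
`y`, `|y| = |x|`, in the generic set; they are disjoint if each `x` has a witness against one side
(`IsLegal`). Given a candidate `B` for a complete pair and a reduction `f`, choose a legal filling
of one level for which the coding words are lexicographically maximal, in the order of their lengths
(`exists_maximal_legal`). The true coding words have certificates that inspect polynomially many
generic words in total (`ones_mem_certificate`; that answers to bit queries depend on few basic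
words, `basic_certificate`, needs the padding of proofs). Hence some input `x` of this level is not
inspected at all. Removing all witnesses for `x` changes no coding word: true ones keep their
certificates, and a newly true one would remain true when one uninspected witness is added, which
restores legality and contradicts maximality. If in this world `f x` lies in both sides of `B`,
then `B` is not disjoint. Otherwise some computation path shows that `f x` is not in some side `i`
of `B`; a witness against the other side `1 - i` that this path does not inspect can be added, so
that `x` lies in side `i` of the pair `j` but `f x` still does not lie in side `i` of `B`
(`exists_diagonal_level`). Repeating this at ever higher levels for all candidates and reductions
gives the generic set (`exists_generic`).
-/

namespace OracleWorld

/-! ### Runs of oracle machines -/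

section Runs

variable {p : Program} {V V' : Set (List Bool)} {g g' : ℕ → Bool} {x : List Bool}

/-- Two oracles give the same answers to the questions in `S`. -/
def AgreeOn (S : Finset (List Bool)) (V V' : Set (List Bool)) : Prop :=
  ∀ w ∈ S, (w ∈ V' ↔ w ∈ V)

theorem AgreeOn.mono {S S' : Finset (List Bool)} (h : AgreeOn S V V') (hS : S' ⊆ S) :
    AgreeOn S' V V' :=
  fun w hw => h w (hS hw)

theorem Program.step_eq {c : Config} {i : Instr} {b : Bool} (h : p[c.pc]? = some i) :
    p.step V b c = i.exec V b c := by
  simp only [Program.step, h]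

theorem Program.step_halted {c : Config} {b : Bool} (h : p[c.pc]? = none) :
    p.step V b c = c := by
  simp only [Program.step, h]

theorem Program.run_halted {s : ℕ} (h : p[(p.run V g x s).pc]? = none) {t : ℕ} (hst : s ≤ t) :
    p.run V g x t = p.run V g x s := by
  induction t, hst using Nat.le_induction with
  | base => rfl
  | succ t _ ih => rw [Program.run, ih, Program.step_halted h]

theorem Program.Outputs.mono {s t : ℕ} {y : List Bool} (h : p.Outputs V g x s y) (hst : s ≤ t) :
    p.Outputs V g x t y := by
  have := Program.run_halted h.1 hst
  exact ⟨by rw [this]; exact h.1, by rw [this]; exact h.2⟩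

theorem Program.Outputs.unique {s t : ℕ} {y z : List Bool} (h : p.Outputs V g x s y)
    (h' : p.Outputs V g x t z) : y = z := by
  have h1 := h.mono (le_max_left s t)
  have h2 := h'.mono (le_max_right s t)
  exact h1.2.symm.trans h2.2

theorem Program.step_congr {c : Config} {b : Bool} (h : c.stk queryStack ∈ V' ↔ c.stk queryStack ∈ V) :
    p.step V' b c = p.step V b c := by
  unfold Program.step
  cases p[c.pc]? with
  | none => rfl
  | some i =>
    cases i with
    | query =>
      by_cases h' : c.stk queryStack ∈ V
      · simp only [Instr.exec, if_pos h', if_pos (h.2 h')]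
      · simp only [Instr.exec, if_neg h', if_neg (fun h'' => h' (h.1 h''))]
    | _ => rfl

theorem Program.run_congr {t : ℕ}
    (h : ∀ s < t, ((p.run V g x s).stk queryStack ∈ V' ↔ (p.run V g x s).stk queryStack ∈ V)) :
    p.run V' g x t = p.run V g x t := by
  induction t with
  | zero => rfl
  | succ t ih =>
    rw [Program.run, Program.run, ih fun s hs => h s (by omega)]
    exact Program.step_congr (h t (by omega))

theorem Program.length_step_stk_le (c : Config) (b : Bool) (k : ℕ) :
    ((p.step V b c).stk k).length ≤ (c.stk k).length + 1 := by
  unfold Program.step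
  cases p[c.pc]? with
  | none => simp
  | some i =>
    cases i with
    | push k' a n =>
      by_cases hk : k = k'
      · subst hk; simp [Instr.exec]
      · simp [Instr.exec, Function.update_of_ne hk]
    | pop k' a n m =>
      simp only [Instr.exec]
      split
      · simp
      all_goals
        rename_i w hw
        by_cases hk : k = k'
        · subst hk; simp [hw]; omega
        · simp [Function.update_of_ne hk]
    | query => simp [Instr.exec]
    | guess => simp [Instr.exec]

theorem Program.length_run_stk_le {k : ℕ} (hk : k ≠ inputStack) (t : ℕ) :
    ((p.run V g x t).stk k).length ≤ t := by
  induction t with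
  | zero => simp [Program.run, Config.init, Function.update_of_ne hk]
  | succ t ih => exact (Program.length_step_stk_le _ _ _).trans (by omega)

theorem Program.run_eq_of_isDeterministic (hp : p.IsDeterministic) (t : ℕ) :
    p.run V g x t = p.run V g' x t := by
  induction t with
  | zero => rfl
  | succ t ih =>
    rw [Program.run, Program.run, ih]
    unfold Program.step
    cases hi : p[(p.run V g' x t).pc]? with
    | none => rfl
    | some i =>
      cases i with
      | guess l l' => exact absurd (List.mem_of_getElem? hi) (hp l l')
      | _ => rfl

/-- A run of `t` steps depends only on the answers to the at most `t` questions that it asks, and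
these are shorter than `t` because the query stack is empty at the start. -/
theorem Program.run_certificate (p : Program) (V : Set (List Bool)) (g : ℕ → Bool) (x : List Bool)
    (t : ℕ) :
    ∃ S : Finset (List Bool), S.card ≤ t ∧ (∀ w ∈ S, w.length < t) ∧
      ∀ V', AgreeOn S V V' → p.run V' g x t = p.run V g x t := by
  classical
  refine ⟨(Finset.range t).image fun s => (p.run V g x s).stk queryStack, ?_, ?_, ?_⟩
  · exact Finset.card_image_le.trans (by simp)
  · intro w hw
    obtain ⟨s, hs, rfl⟩ := Finset.mem_image.1 hw
    exact (Program.length_run_stk_le (by decide) s).trans_lt (Finset.mem_range.1 hs)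
  · intro V' h
    exact Program.run_congr fun s hs =>
      h _ (Finset.mem_image_of_mem _ (Finset.mem_range.2 hs))

end Runs

/-! ### Codes of formulas and dependence of truth values on the oracle -/

theorem encodeNat_prefix_free {m n : ℕ} {r s : List Bool}
    (h : encodeNat m ++ r = encodeNat n ++ s) : m = n ∧ r = s := by
  have key : ∀ (a b : List Bool) (r s : List Bool),
      a.flatMap (fun b => [b, b]) ++ [false, true] ++ r =
        b.flatMap (fun b => [b, b]) ++ [false, true] ++ s → a = b ∧ r = s := by
    intro a
    induction a with
    | nil =>
      intro b r s h
      cases b with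
      | nil => simpa using h
      | cons c b => cases c <;> simp at h
    | cons d a ih =>
      intro b r s h
      cases b with
      | nil => cases d <;> simp at h
      | cons c b =>
        simp only [List.flatMap_cons, List.cons_append, List.nil_append, List.cons.injEq] at h
        obtain ⟨rfl, -, h⟩ := h
        obtain ⟨rfl, rfl⟩ := ih b r s (by simpa using h)
        exact ⟨rfl, rfl⟩
  obtain ⟨hb, hr⟩ := key _ _ _ _ h
  refine ⟨?_, hr⟩
  have := congrArg (fun l : List Bool => Nat.ofDigits 2 (l.map fun b => cond b 1 0)) hb
  simpa [← Nat.digits_two_eq_bits, Nat.ofDigits_digits] using this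

theorem flatten_ofFn_prefix_free {α : Type*} {e : α → List Bool} {n : ℕ} {a b : Fin n → α}
    (he : ∀ i, ∀ c r s, e (a i) ++ r = e c ++ s → a i = c ∧ r = s) {r s : List Bool}
    (h : (List.ofFn fun i => e (a i)).flatten ++ r = (List.ofFn fun i => e (b i)).flatten ++ s) :
    a = b ∧ r = s := by
  induction n with
  | zero => exact ⟨Subsingleton.elim _ _, by simpa using h⟩
  | succ n ih =>
    simp only [List.ofFn_succ, List.flatten_cons, List.append_assoc] at h
    obtain ⟨h0, h⟩ := he 0 _ _ _ h
    obtain ⟨h1, h⟩ := ih (a := fun i => a i.succ) (b := fun i => b i.succ)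
      (fun i => he i.succ) h
    refine ⟨funext fun i => Fin.cases h0 (fun i => congrFun h1 i) i, h⟩

theorem Formula.encode_prefix_free (φ : Formula) :
    ∀ (ψ : Formula) (r s : List Bool), φ.encode ++ r = ψ.encode ++ s → φ = ψ ∧ r = s := by
  induction φ with
  | const b =>
    intro ψ r s h
    cases ψ <;> simp [Formula.encode] at h
    simp [h]
  | var i =>
    intro ψ r s h
    cases ψ <;> simp [Formula.encode] at h
    obtain ⟨rfl, rfl⟩ := encodeNat_prefix_free h
    exact ⟨rfl, rfl⟩
  | neg φ ih =>
    intro ψ r s h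
    cases ψ <;> simp [Formula.encode] at h
    obtain ⟨rfl, rfl⟩ := ih _ _ _ h
    exact ⟨rfl, rfl⟩
  | and φ φ' ih ih' =>
    intro ψ r s h
    cases ψ <;> simp [Formula.encode] at h
    obtain ⟨h₁, h₂⟩ := ih _ _ _ h
    obtain ⟨h₃, h₄⟩ := ih' _ _ _ h₂
    exact ⟨by rw [h₁, h₃], h₄⟩
  | or φ φ' ih ih' =>
    intro ψ r s h
    cases ψ <;> simp [Formula.encode] at h
    obtain ⟨h₁, h₂⟩ := ih _ _ _ h
    obtain ⟨h₃, h₄⟩ := ih' _ _ _ h₂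
    exact ⟨by rw [h₁, h₃], h₄⟩
  | oracle n φ ih =>
    intro ψ r s h
    cases ψ <;> simp only [Formula.encode, List.cons_append, List.nil_append, List.append_assoc,
      List.cons.injEq, reduceCtorEq, false_and, and_false, true_and] at h
    obtain ⟨rfl, h⟩ := encodeNat_prefix_free h
    obtain ⟨rfl, rfl⟩ := flatten_ofFn_prefix_free (e := Formula.encode) ih h
    exact ⟨rfl, rfl⟩

theorem Formula.encode_injective : Function.Injective Formula.encode := fun φ ψ h =>
  (φ.encode_prefix_free ψ [] [] (by simpa using h)).1

theorem Formula.length_encode_pos (φ : Formula) : 0 < φ.encode.length := by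
  cases φ <;> simp [Formula.encode]

/-- Every oracle gate is paid for by the code: the truth value of `φ` depends on at most
`|φ.encode|` oracle answers, to questions shorter than the code. -/
theorem Formula.eval_certificate (V : Set (List Bool)) (v : ℕ → Bool) (φ : Formula) :
    ∃ S : Finset (List Bool), S.card ≤ φ.encode.length ∧ (∀ w ∈ S, w.length < φ.encode.length) ∧
      ∀ V', AgreeOn S V V' → φ.eval V' v = φ.eval V v := by
  classical
  have two : ∀ φ ψ : Formula,
      (∃ S : Finset (List Bool), S.card ≤ φ.encode.length ∧ (∀ w ∈ S, w.length < φ.encode.length) ∧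
        ∀ V', AgreeOn S V V' → φ.eval V' v = φ.eval V v) →
      (∃ S : Finset (List Bool), S.card ≤ ψ.encode.length ∧ (∀ w ∈ S, w.length < ψ.encode.length) ∧
        ∀ V', AgreeOn S V V' → ψ.eval V' v = ψ.eval V v) →
      ∃ S : Finset (List Bool), S.card ≤ φ.encode.length + ψ.encode.length ∧
        (∀ w ∈ S, w.length < φ.encode.length + ψ.encode.length) ∧
        ∀ V', AgreeOn S V V' → φ.eval V' v = φ.eval V v ∧ ψ.eval V' v = ψ.eval V v := by
    rintro φ ψ ⟨S, hS, hS', hS''⟩ ⟨S₁, h₁, h₁', h₁''⟩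
    refine ⟨S ∪ S₁, (Finset.card_union_le _ _).trans (by omega), fun w hw => ?_, fun V' h =>
      ⟨hS'' V' (h.mono Finset.subset_union_left), h₁'' V' (h.mono Finset.subset_union_right)⟩⟩
    rcases Finset.mem_union.1 hw with hw | hw
    · have := hS' w hw; omega
    · have := h₁' w hw; omega
  induction φ with
  | const b => exact ⟨∅, by simp, by simp, fun V' _ => by simp [Formula.eval]⟩
  | var i => exact ⟨∅, by simp, by simp, fun V' _ => by simp [Formula.eval]⟩
  | neg φ ih =>
    obtain ⟨S, hS, hS', hS''⟩ := ih
    refine ⟨S, by simp [Formula.encode]; omega, fun w hw => ?_, fun V' h => ?_⟩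
    · have := hS' w hw
      simp [Formula.encode]; omega
    · simp only [Formula.eval, hS'' V' h]
  | and φ ψ ih ih' =>
    obtain ⟨S, hS, hS', hS''⟩ := two φ ψ ih ih'
    refine ⟨S, by simp [Formula.encode]; omega, fun w hw => ?_, fun V' h => ?_⟩
    · have := hS' w hw
      simp [Formula.encode]; omega
    · simp only [Formula.eval, hS'' V' h]
  | or φ ψ ih ih' =>
    obtain ⟨S, hS, hS', hS''⟩ := two φ ψ ih ih'
    refine ⟨S, by simp [Formula.encode]; omega, fun w hw => ?_, fun V' h => ?_⟩
    · have := hS' w hw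
      simp [Formula.encode]; omega
    · simp only [Formula.eval, hS'' V' h]
  | oracle n φ ih =>
    choose S hS hS' hS'' using ih
    have hlen : (Formula.oracle n φ).encode.length
        = 3 + (encodeNat n).length + ∑ i, (φ i).encode.length := by
      simp [Formula.encode, List.length_flatten, List.map_ofFn, List.sum_ofFn]
      omega
    have hn : n ≤ ∑ i, (φ i).encode.length := by
      calc n = ∑ _i : Fin n, 1 := by simp
        _ ≤ _ := Finset.sum_le_sum fun i _ => (φ i).length_encode_pos
    refine ⟨insert (List.ofFn fun i => (φ i).eval V v) (Finset.univ.biUnion S), ?_, ?_, ?_⟩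
    · have h1 : (Finset.univ.biUnion S).card ≤ ∑ i, (φ i).encode.length :=
        Finset.card_biUnion_le.trans (Finset.sum_le_sum fun i _ => hS i)
      have h2 := Finset.card_insert_le (List.ofFn fun i => (φ i).eval V v) (Finset.univ.biUnion S)
      omega
    · intro w hw
      rcases Finset.mem_insert.1 hw with rfl | hw
      · rw [List.length_ofFn]; omega
      · obtain ⟨i, -, hi⟩ := Finset.mem_biUnion.1 hw
        have h1 := hS' i w hi
        have h2 := Finset.single_le_sum (f := fun i => (φ i).encode.length)
          (fun i _ => Nat.zero_le _) (Finset.mem_univ i)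
        omega
    · intro V' h
      have h1 : ∀ i, (φ i).eval V' v = (φ i).eval V v := fun i =>
        hS'' i V' fun w hw => h w (Finset.mem_insert_of_mem
          (Finset.mem_biUnion.2 ⟨i, Finset.mem_univ i, hw⟩))
      simp only [Formula.eval, h1, h _ (Finset.mem_insert_self _ _)]

/-- That a word is not a tautology is witnessed by one falsifying assignment. -/
theorem not_mem_TAUT_certificate {V : Set (List Bool)} {o : List Bool} (ho : o ∉ TAUT V) :
    ∃ S : Finset (List Bool), S.card ≤ o.length ∧ (∀ w ∈ S, w.length < o.length) ∧
      ∀ V', AgreeOn S V V' → o ∉ TAUT V' := by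
  by_cases hφ : ∃ φ : Formula, φ.encode = o
  · obtain ⟨φ, rfl⟩ := hφ
    obtain ⟨v, hv⟩ : ∃ v, ¬ φ.eval V v = true := by
      by_contra h
      push Not at h
      exact ho ⟨φ, rfl, h⟩
    obtain ⟨S, hS, hS', hS''⟩ := φ.eval_certificate V v
    refine ⟨S, hS, hS', fun V' h => ?_⟩
    rintro ⟨ψ, hψ, hv'⟩
    obtain rfl := Formula.encode_injective hψ
    exact hv (hS'' V' h ▸ hv' v)
  · exact ⟨∅, by simp, by simp, fun V' _ ⟨ψ, hψ, _⟩ => hφ ⟨ψ, hψ⟩⟩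

/-! ### Words as numbers, enumeration of programs -/

/-- The word `x`, read as the binary expansion `1x` with the least significant bit first. -/
def wordNum (x : List Bool) : ℕ := x.foldr Nat.bit 1

/-- The word with number `a`. -/
def numWord (a : ℕ) : List Bool := a.bits.dropLast

theorem wordNum_ne_zero (x : List Bool) : wordNum x ≠ 0 := by
  induction x with
  | nil => simp [wordNum]
  | cons b x ih =>
    change Nat.bit b (wordNum x) ≠ 0
    rw [Nat.bit_ne_zero_iff]
    exact fun h => absurd h ih

theorem numWord_wordNum (x : List Bool) : numWord (wordNum x) = x := by
  have h : (wordNum x).bits = x ++ [true] := by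
    induction x with
    | nil => simp [wordNum]
    | cons b x ih =>
      change (Nat.bit b (wordNum x)).bits = _
      rw [Nat.bits_append_bit _ _ fun h => absurd h (wordNum_ne_zero x), ih]
      rfl
  simp [numWord, h]

theorem wordNum_lt (x : List Bool) : wordNum x < 2 ^ (x.length + 1) := by
  induction x with
  | nil => simp [wordNum]
  | cons b x ih =>
    change Nat.bit b (wordNum x) < _
    rw [List.length_cons, pow_succ]
    cases b <;> simp only [Nat.bit_val] <;> simp <;> omega

instance : Countable Instr := by
  let enc : Instr → ℕ × ℕ × ℕ × ℕ × ℕ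
    | .push k b n => (0, k, b.toNat, n, 0)
    | .pop k a b c => (1, k, a, b, c)
    | .query a b => (2, a, b, 0, 0)
    | .guess a b => (3, a, b, 0, 0)
  refine Function.Injective.countable (f := enc) fun i j h => ?_
  cases i <;> cases j <;> simp_all [enc]
  rename_i b _ _ b' _
  revert h
  cases b <;> cases b' <;> simp

/-- An enumeration of all programs. -/
noncomputable def prog : ℕ → Program := Classical.choose (exists_surjective_nat Program)

theorem prog_surjective : Function.Surjective prog :=
  Classical.choose_spec (exists_surjective_nat Program)

/-- Split a word after its first `false`: the number of leading `true`s, and the rest of the word,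
which is `none` if there is no `false`. -/
def unary : List Bool → ℕ × Option (List Bool)
  | [] => (0, none)
  | false :: w => (0, some w)
  | true :: w => ((unary w).1 + 1, (unary w).2)

/-- The word `1ⁿ`. -/
abbrev ones (n : ℕ) : List Bool := List.replicate n true

@[simp] theorem unary_ones (n : ℕ) : unary (ones n) = (n, none) := by
  induction n with
  | zero => rfl
  | succ n ih => simp only [ones, List.replicate_succ, unary] at ih ⊢; rw [ih]

@[simp] theorem unary_ones_append (n : ℕ) (w : List Bool) :
    unary (ones n ++ false :: w) = (n, some w) := by
  induction n with
  | zero => rfl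
  | succ n ih => simp only [ones, List.replicate_succ, List.cons_append, unary] at ih ⊢; rw [ih]

theorem eq_ones_or_exists (w : List Bool) :
    (∃ n, w = ones n) ∨ ∃ n u, w = ones n ++ false :: u := by
  induction w with
  | nil => exact .inl ⟨0, rfl⟩
  | cons b w ih =>
    cases b with
    | false => exact .inr ⟨0, w, rfl⟩
    | true =>
      rcases ih with ⟨n, rfl⟩ | ⟨n, u, rfl⟩
      · exact .inl ⟨n + 1, rfl⟩
      · exact .inr ⟨n + 1, u, rfl⟩

/-! ### The oracle -/

/-- Meaning of the coding word `1ᴺ`. Either `N` is the number of a nondeterministic program, an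
input and a time bound, and the word says that some computation path accepts; or `N` is the number
of a program and a time bound `T`, and the word says that the program is unsound at `T`: on some
input it halts within `T` steps with an output that is not a tautology. -/
def CodeTrue (U : Set (List Bool)) (N : ℕ) : Prop :=
  if N.unpair.1 = 0 then
    ∃ g, (prog N.unpair.2.unpair.1).Outputs U g (numWord N.unpair.2.unpair.2.unpair.2)
      N.unpair.2.unpair.2.unpair.1 [true]
  else
    ∃ x o, (prog N.unpair.2.unpair.1).Outputs U (fun _ => false) x N.unpair.2.unpair.2 o ∧
      o ∉ TAUT U

/-- The number of the statement that program `e` accepts `x` in time `T`. -/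
def acceptNum (e T : ℕ) (x : List Bool) : ℕ :=
  Nat.pair 0 (Nat.pair e (Nat.pair T (wordNum x)))

/-- The number of the statement that program `e` is unsound at time `T`. -/
def unsoundNum (e T : ℕ) : ℕ := Nat.pair 1 (Nat.pair e T)

open Classical in
/-- The proof system: `1ᴹ0π`, where `M` is the number of the statement that program `e` is unsound
at time `T`, is a proof of the output of program `e` on `π`, provided that the program halts within
`T` steps and that `1ᴹ` is not in the oracle. All other words are proofs of one fixed tautology. -/
noncomputable def proofSystem (U : Set (List Bool)) (w : List Bool) : List Bool :=
  match unary w with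
  | (M, some π) =>
    let r := (prog M.unpair.2.unpair.1).run U (fun _ => false) π M.unpair.2.unpair.2
    if M.unpair.1 ≠ 0 ∧ ones M ∉ U ∧ (prog M.unpair.2.unpair.1)[r.pc]? = none then
      r.stk outputStack
    else (Formula.const true).encode
  | (_, none) => (Formula.const true).encode

/-- The functions whose output bits the oracle supplies: the proof system, the translations of
proofs into it, and the reductions of nondeterministic exponential time to the coding words. -/
noncomputable def bitFun (U : Set (List Bool)) (k : ℕ) (x : List Bool) : List Bool :=
  match k.unpair.1 with
  | 0 => proofSystem U x
  | 1 =>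
    ones (unsoundNum k.unpair.2.unpair.1 (x.length ^ k.unpair.2.unpair.2 + k.unpair.2.unpair.2)) ++
      false :: x
  | _ =>
    ones (acceptNum k.unpair.2.unpair.1
      (2 ^ (k.unpair.2.unpair.2 * x.length + k.unpair.2.unpair.2)) x)

/-- The condition for membership of `w` in the oracle with generic part `G`, where `U` stands for
the part of the oracle below the length of `w`. The words `1ᴺ` code statements, the words `0u`
are generic, and the words `1ⁱ⁺¹01ᵏ0r` tell the bits of the functions `bitFun`. Output words are
told from their last bit, because a machine pushes that bit first; there are two questions for each
bit, so that the end of the word can be recognized. -/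
def OracleRule (G U : Set (List Bool)) (w : List Bool) : Prop :=
  match unary w with
  | (N, none) => CodeTrue U N
  | (0, some _) => w ∈ G
  | (i + 1, some u) =>
    match unary u with
    | (_, none) => False
    | (k, some r) => (bitFun U k r.reverse).reverse[i / 2]? = some (i % 2 == 0)

/-- Membership in the oracle with generic part `G`, by recursion on the length of the word. -/
def InOracle (G : Set (List Bool)) (w : List Bool) : Prop :=
  OracleRule G {u | ∃ _ : u.length < w.length, InOracle G u} w
termination_by w.length

/-- The oracle with generic part `G`. -/
def oracleOf (G : Set (List Bool)) : Set (List Bool) := {w | InOracle G w}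

theorem mem_oracleOf {G : Set (List Bool)} {w : List Bool} :
    w ∈ oracleOf G ↔ OracleRule G {u | u.length < w.length ∧ u ∈ oracleOf G} w := by
  change InOracle G w ↔ _
  rw [InOracle]
  simp only [exists_prop, oracleOf, Set.mem_ofPred_eq]

/-! ### How the words of the oracle depend on each other -/

/-- A true coding word has a small certificate. -/
theorem CodeTrue.certificate {U : Set (List Bool)} {N : ℕ} (h : CodeTrue U N) :
    ∃ S : Finset (List Bool), S.card ≤ 2 * N ∧ (∀ w ∈ S, w.length < N) ∧
      ∀ U', AgreeOn S U U' → CodeTrue U' N := by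
  classical
  unfold CodeTrue at h
  split_ifs at h with h0
  · obtain ⟨g, h⟩ := h
    obtain ⟨S, hS, hS', hS''⟩ := Program.run_certificate (prog N.unpair.2.unpair.1) U g
      (numWord N.unpair.2.unpair.2.unpair.2) N.unpair.2.unpair.2.unpair.1
    have hT : N.unpair.2.unpair.2.unpair.1 ≤ N :=
      (Nat.unpair_left_le _).trans ((Nat.unpair_right_le _).trans (Nat.unpair_right_le _))
    refine ⟨S, by omega, fun w hw => (hS' w hw).trans_le hT, fun U' hU' => ?_⟩
    rw [CodeTrue, if_pos h0]
    refine ⟨g, ?_⟩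
    unfold Program.Outputs
    rw [hS'' U' hU']
    exact h
  · obtain ⟨x, o, h, ho⟩ := h
    obtain ⟨S, hS, hS', hS''⟩ := Program.run_certificate (prog N.unpair.2.unpair.1) U
      (fun _ => false) x N.unpair.2.unpair.2
    obtain ⟨S₁, h₁, h₁', h₁''⟩ := not_mem_TAUT_certificate ho
    have hT : N.unpair.2.unpair.2 ≤ N := (Nat.unpair_right_le _).trans (Nat.unpair_right_le _)
    have hoT : o.length ≤ N.unpair.2.unpair.2 := by
      rw [← h.2]; exact Program.length_run_stk_le (by decide) _
    refine ⟨S ∪ S₁, (Finset.card_union_le _ _).trans (by omega), fun w hw => ?_,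
      fun U' hU' => ?_⟩
    · rcases Finset.mem_union.1 hw with hw | hw
      · exact (hS' w hw).trans_le hT
      · exact (h₁' w hw).trans_le (hoT.trans hT)
    · rw [CodeTrue, if_neg h0]
      refine ⟨x, o, ?_, h₁'' U' (hU'.mono Finset.subset_union_right)⟩
      unfold Program.Outputs
      rw [hS'' U' (hU'.mono Finset.subset_union_left)]
      exact h

theorem CodeTrue.congr {U U' : Set (List Bool)} {N : ℕ}
    (h : ∀ w : List Bool, w.length < N → (w ∈ U' ↔ w ∈ U)) : CodeTrue U' N ↔ CodeTrue U N := by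
  constructor
  · intro h'
    obtain ⟨S, -, hS, hS'⟩ := h'.certificate
    exact hS' U fun w hw => (h w (hS w hw)).symm
  · intro h'
    obtain ⟨S, -, hS, hS'⟩ := h'.certificate
    exact hS' U' fun w hw => h w (hS w hw)

theorem length_unary {w u : List Bool} {n : ℕ} (h : unary w = (n, some u)) :
    w.length = n + u.length + 1 := by
  rcases eq_ones_or_exists w with ⟨m, rfl⟩ | ⟨m, v, rfl⟩
  · simp at h
  · simp only [unary_ones_append, Prod.mk.injEq, Option.some.injEq] at h
    obtain ⟨rfl, rfl⟩ := h
    simp; omega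

/-- The numbers of statements about time `T` are at least quadratic in `T`. This makes the words
that ask for the bits of a simulation so long that each bit depends on few basic words. -/
theorem sq_time_le {M : ℕ} (hM : M.unpair.1 ≠ 0) :
    M.unpair.2.unpair.2 * M.unpair.2.unpair.2 + M.unpair.2.unpair.2 ≤ M := by
  set k := M.unpair.1
  set b := M.unpair.2 with hb
  set T := b.unpair.2
  have hbT : T * T ≤ b := by
    rw [← Nat.pair_unpair b]
    change T * T ≤ Nat.pair b.unpair.1 T
    unfold Nat.pair
    split_ifs with h
    · omega
    · have : T * T ≤ b.unpair.1 * b.unpair.1 := Nat.mul_le_mul (by omega) (by omega)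
      omega
  have hMb : b + b ≤ M ∨ b = 0 := by
    rw [← Nat.pair_unpair M]
    change b + b ≤ Nat.pair k b ∨ b = 0
    unfold Nat.pair
    rcases Nat.eq_zero_or_pos b with h0 | h0
    · exact .inr h0
    left
    split_ifs with h
    · nlinarith [Nat.pos_of_ne_zero hM]
    · nlinarith [Nat.pos_of_ne_zero hM]
  rcases hMb with h | h
  · nlinarith
  · have : T = 0 := by nlinarith
    simp [this]

/-- The functions `bitFun` depend on the oracle only through one coding word and a few short
words. -/
theorem bitFun_certificate (U : Set (List Bool)) (k : ℕ) (x : List Bool) :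
    ∃ (t N : ℕ) (S : Finset (List Bool)), t * t + t ≤ x.length ∧ N ≤ x.length ∧ S.card ≤ t ∧
      (∀ w ∈ S, w.length < t) ∧
      ∀ U', AgreeOn S U U' → (ones N ∈ U' ↔ ones N ∈ U) → bitFun U' k x = bitFun U k x := by
  unfold bitFun
  split
  · cases hx : unary x with
    | mk M o =>
      cases o with
      | none =>
        exact ⟨0, 0, ∅, by simp, by simp, by simp, by simp, fun U' _ _ => by
          simp only [proofSystem, hx]⟩
      | some π =>
        have hlen := length_unary hx
        by_cases hM : M.unpair.1 = 0
        · exact ⟨0, 0, ∅, by simp, by simp, by simp, by simp, fun U' _ _ => by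
            simp [proofSystem, hx, hM]⟩
        · obtain ⟨S, hS, hS', hS''⟩ := Program.run_certificate (prog M.unpair.2.unpair.1) U
            (fun _ => false) π M.unpair.2.unpair.2
          refine ⟨_, M, S, (sq_time_le hM).trans (by omega), by omega, hS, hS', fun U' h h' => ?_⟩
          simp only [proofSystem, hx]
          rw [hS'' U' h]
          rw [propext h']
  · exact ⟨0, 0, ∅, by simp, by simp, by simp, by simp, fun U' _ _ => rfl⟩
  · exact ⟨0, 0, ∅, by simp, by simp, by simp, by simp, fun U' _ _ => rfl⟩

theorem bitFun_congr {U U' : Set (List Bool)} {k : ℕ} {x : List Bool}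
    (h : ∀ w : List Bool, w.length ≤ x.length → (w ∈ U' ↔ w ∈ U)) :
    bitFun U' k x = bitFun U k x := by
  obtain ⟨t, N, S, ht, hN, -, hS, hS'⟩ := bitFun_certificate U k x
  refine hS' U' (fun w hw => h w ?_) (h _ (by simpa using hN))
  have := hS w hw
  nlinarith

theorem ones_mem_oracleOf {G : Set (List Bool)} {N : ℕ} :
    ones N ∈ oracleOf G ↔ CodeTrue (oracleOf G) N := by
  rw [mem_oracleOf]
  unfold OracleRule
  simp only [unary_ones]
  exact CodeTrue.congr fun w hw => by simp [hw]

theorem false_cons_mem_oracleOf {G : Set (List Bool)} {u : List Bool} :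
    false :: u ∈ oracleOf G ↔ false :: u ∈ G := by
  rw [mem_oracleOf]
  simp [OracleRule, unary]

theorem bit_mem_oracleOf {G : Set (List Bool)} {i k : ℕ} {r : List Bool} :
    ones (i + 1) ++ false :: (ones k ++ false :: r) ∈ oracleOf G ↔
      (bitFun (oracleOf G) k r.reverse).reverse[i / 2]? = some (i % 2 == 0) := by
  rw [mem_oracleOf]
  unfold OracleRule
  simp only [unary_ones_append]
  rw [bitFun_congr fun w hw => ?_]
  simp only [List.length_reverse] at hw
  have : w.length < (ones (i + 1) ++ false :: (ones k ++ false :: r)).length := by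
    simp; omega
  simp [-List.length_append, this]

theorem not_mem_oracleOf {G : Set (List Bool)} {i k : ℕ} :
    ones (i + 1) ++ false :: ones k ∉ oracleOf G := by
  rw [mem_oracleOf]
  unfold OracleRule
  simp

/-- Basic words: the coding words and the generic words. -/
def IsBasic (w : List Bool) : Prop := (∃ N, w = ones N) ∨ ∃ u, w = false :: u

/-- Membership of a word in the oracle depends on few basic words that are not longer. -/
theorem basic_certificate (G : Set (List Bool)) (w : List Bool) :
    ∃ T : Finset (List Bool), T.card ≤ w.length + 1 ∧
      (∀ u ∈ T, IsBasic u ∧ u.length ≤ w.length) ∧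
      ∀ G', AgreeOn T (oracleOf G) (oracleOf G') → (w ∈ oracleOf G' ↔ w ∈ oracleOf G) := by
  classical
  induction hn : w.length using Nat.strong_induction_on generalizing w with
  | _ n ih =>
    subst hn
    have basic : IsBasic w → ∃ T : Finset (List Bool), T.card ≤ w.length + 1 ∧
        (∀ u ∈ T, IsBasic u ∧ u.length ≤ w.length) ∧
        ∀ G', AgreeOn T (oracleOf G) (oracleOf G') → (w ∈ oracleOf G' ↔ w ∈ oracleOf G) :=
      fun hw => ⟨{w}, by simp, by simpa using hw, fun G' h => h w (by simp)⟩
    rcases eq_ones_or_exists w with hw | ⟨i, u, hw⟩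
    · exact basic (.inl hw)
    cases i with
    | zero => exact basic (.inr ⟨u, by simpa using hw⟩)
    | succ i =>
      rcases eq_ones_or_exists u with ⟨k, rfl⟩ | ⟨k, r, rfl⟩
      · refine ⟨∅, by simp, by simp, fun G' _ => ?_⟩
        rw [hw]
        exact iff_of_false not_mem_oracleOf not_mem_oracleOf
      · obtain ⟨t, N, S, ht, hN, hS, hS', hS''⟩ := bitFun_certificate (oracleOf G) k r.reverse
        have hlen : r.reverse.length + 3 ≤ w.length := by
          rw [hw]; simp; omega
        have htt : t ≤ r.reverse.length := by nlinarith
        have hE : ∀ u : List Bool, ∃ T : Finset (List Bool), u ∈ S → T.card ≤ t ∧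
            (∀ u' ∈ T, IsBasic u' ∧ u'.length ≤ w.length) ∧
            ∀ G', AgreeOn T (oracleOf G) (oracleOf G') →
              (u ∈ oracleOf G' ↔ u ∈ oracleOf G) := by
          intro u
          by_cases hu : u ∈ S
          · have hut := hS' u hu
            obtain ⟨T, hT, hT', hT''⟩ := ih u.length (by omega) u rfl
            exact ⟨T, fun _ => ⟨by omega, fun u' hu' => ⟨(hT' u' hu').1, by
              have := (hT' u' hu').2; omega⟩, hT''⟩⟩
          · exact ⟨∅, fun h => absurd h hu⟩
        choose E hE using hE
        refine ⟨insert (ones N) (S.biUnion E), ?_, ?_, fun G' h => ?_⟩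
        · have h1 : (S.biUnion E).card ≤ S.card * t :=
            Finset.card_biUnion_le_card_mul _ _ _ fun u hu => (hE u hu).1
          have h2 := Finset.card_insert_le (ones N) (S.biUnion E)
          have h3 : S.card * t ≤ t * t := Nat.mul_le_mul_right _ hS
          omega
        · intro u hu
          rcases Finset.mem_insert.1 hu with rfl | hu
          · exact ⟨.inl ⟨N, rfl⟩, by simp only [List.length_replicate]; omega⟩
          · obtain ⟨v, hv, hu⟩ := Finset.mem_biUnion.1 hu
            exact (hE v hv).2.1 u hu
        · rw [hw, bit_mem_oracleOf, bit_mem_oracleOf, hS'' (oracleOf G')]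
          · exact fun u hu => (hE u hu).2.2 G' (h.mono ((Finset.subset_biUnion_of_mem E hu).trans
              (Finset.subset_insert _ _)))
          · exact h _ (Finset.mem_insert_self _ _)

/-- All answers to a set of at most `m` questions shorter than `ℓ` depend on at most `m * ℓ` basic
words shorter than `ℓ`. -/
theorem basic_certificate_finset (G : Set (List Bool)) {S : Finset (List Bool)} {m ℓ : ℕ}
    (hm : S.card ≤ m) (hℓ : ∀ w ∈ S, w.length < ℓ) :
    ∃ T : Finset (List Bool), T.card ≤ m * ℓ ∧ (∀ u ∈ T, IsBasic u ∧ u.length < ℓ) ∧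
      ∀ G', AgreeOn T (oracleOf G) (oracleOf G') → AgreeOn S (oracleOf G) (oracleOf G') := by
  classical
  choose E hE hE' hE'' using basic_certificate G
  refine ⟨S.biUnion E, ?_, ?_, fun G' h w hw =>
    hE'' w G' (h.mono (Finset.subset_biUnion_of_mem E hw))⟩
  · exact (Finset.card_biUnion_le_card_mul _ _ ℓ fun u hu => (hE u).trans (hℓ u hu)).trans
      (Nat.mul_le_mul_right _ hm)
  · intro u hu
    obtain ⟨v, hv, hu⟩ := Finset.mem_biUnion.1 hu
    exact ⟨(hE' v u hu).1, ((hE' v u hu).2).trans_lt (hℓ v hv)⟩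

/-- The oracle below a length is determined by its generic part below this length. -/
theorem oracleOf_congr {G G' : Set (List Bool)} {L : ℕ}
    (h : ∀ w : List Bool, w.length < L → (w ∈ G' ↔ w ∈ G)) {w : List Bool} (hw : w.length < L) :
    w ∈ oracleOf G' ↔ w ∈ oracleOf G := by
  induction hn : w.length using Nat.strong_induction_on generalizing w with
  | _ n ih =>
    subst hn
    rw [mem_oracleOf, mem_oracleOf]
    have hU : {u | u.length < w.length ∧ u ∈ oracleOf G'} =
        {u | u.length < w.length ∧ u ∈ oracleOf G} := by
      ext u
      simp only [Set.mem_ofPred_eq, and_congr_right_iff]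
      exact fun hu => ih u.length hu (hu.trans hw) rfl
    rw [hU]
    unfold OracleRule
    split
    · rfl
    · exact h w hw
    · rfl

/-! ### Polynomial bounds -/

/-- Functions bounded by a polynomial. -/
def PolyBounded (f : ℕ → ℕ) : Prop := ∃ d, ∀ n, f n ≤ (n + 2) ^ d

namespace PolyBounded

variable {f g : ℕ → ℕ}

theorem const (c : ℕ) : PolyBounded fun _ => c :=
  ⟨c, fun n => Nat.lt_two_pow_self.le.trans (Nat.pow_le_pow_left (by omega) c)⟩

theorem id : PolyBounded fun n => n := ⟨1, fun n => by simp⟩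

theorem add (hf : PolyBounded f) (hg : PolyBounded g) : PolyBounded fun n => f n + g n := by
  obtain ⟨a, ha⟩ := hf
  obtain ⟨b, hb⟩ := hg
  refine ⟨max a b + 1, fun n => ?_⟩
  have h1 : (n + 2) ^ a ≤ (n + 2) ^ max a b := Nat.pow_le_pow_right (by omega) (le_max_left a b)
  have h2 : (n + 2) ^ b ≤ (n + 2) ^ max a b := Nat.pow_le_pow_right (by omega) (le_max_right a b)
  have h3 : (n + 2) ^ max a b * 2 ≤ (n + 2) ^ (max a b + 1) := by
    rw [pow_succ]; exact Nat.mul_le_mul_left _ (by omega)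
  have := ha n
  have := hb n
  simp only
  omega

theorem mul (hf : PolyBounded f) (hg : PolyBounded g) : PolyBounded fun n => f n * g n := by
  obtain ⟨a, ha⟩ := hf
  obtain ⟨b, hb⟩ := hg
  exact ⟨a + b, fun n => by rw [pow_add]; exact Nat.mul_le_mul (ha n) (hb n)⟩

theorem pow (hf : PolyBounded f) (k : ℕ) : PolyBounded fun n => f n ^ k := by
  obtain ⟨a, ha⟩ := hf
  exact ⟨a * k, fun n => by rw [pow_mul]; exact Nat.pow_le_pow_left (ha n) k⟩

/-- A polynomially bounded function has a bound of the form used in the definition of `FP`. -/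
theorem exists_le_pow_add (hf : PolyBounded f) : ∃ c, ∀ n, f n ≤ n ^ c + c := by
  obtain ⟨d, hd⟩ := hf
  refine ⟨2 * d + 3 ^ d, fun n => (hd n).trans ?_⟩
  rcases Nat.lt_or_ge n 2 with hn | hn
  · have : (n + 2) ^ d ≤ 3 ^ d := Nat.pow_le_pow_left (by omega) d
    omega
  · have h1 : (n + 2) ^ d ≤ (n ^ 2) ^ d := Nat.pow_le_pow_left (by nlinarith) d
    have h2 : n ^ (2 * d) ≤ n ^ (2 * d + 3 ^ d) := Nat.pow_le_pow_right (by omega) (Nat.le_add_right _ _)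
    rw [← pow_mul] at h1
    exact (h1.trans h2).trans (Nat.le_add_right _ _)

theorem exists_lt_two_pow (hf : PolyBounded f) (m : ℕ) : ∃ n ≥ m, f n < 2 ^ n := by
  obtain ⟨d, hd⟩ := hf
  have h := (tendsto_pow_const_div_const_pow_of_one_lt d (r := (2 : ℝ)) (by norm_num)).eventually
    (gt_mem_nhds (show (0 : ℝ) < 1 / 4 by norm_num))
  obtain ⟨a, ha⟩ := Filter.eventually_atTop.1 h
  refine ⟨max a m, le_max_right _ _, (hd _).trans_lt ?_⟩
  have h1 := ha (max a m + 2) (by omega)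
  rw [div_lt_iff₀ (by positivity), pow_add] at h1
  have h2 : ((max a m + 2 : ℕ) : ℝ) ^ d < 2 ^ max a m := by linarith
  exact_mod_cast h2

end PolyBounded

theorem two_pow_le_card {α : Type*} {n : ℕ} {T : Finset α} (F : List Bool → α)
    (hF : ∀ x, x.length = n → F x ∈ T)
    (hinj : ∀ x y, x.length = n → y.length = n → F x = F y → x = y) : 2 ^ n ≤ T.card := by
  have h := Finset.card_le_card_of_injOn (s := (Finset.univ : Finset (List.Vector Bool n)))
    (t := T) (fun x => F x.1) (fun x _ => hF _ x.2)
    (fun x _ y _ h => Subtype.ext (hinj _ _ x.2 y.2 h))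
  simpa using h

/-! ### The generic words of a level -/

/-- The word formed by the bits of the pairs in `l`, the second bit of each pair coming first. -/
def interleave : List (Bool × Bool) → List Bool
  | [] => []
  | (a, b) :: l => b :: a :: interleave l

theorem interleave_injective : Function.Injective interleave := by
  intro l
  induction l with
  | nil => rintro (_ | ⟨⟨c, d⟩, l'⟩) h <;> simp_all [interleave]
  | cons a l ih =>
    obtain ⟨a, b⟩ := a
    rintro (_ | ⟨⟨c, d⟩, l'⟩) h
    · simp [interleave] at h
    · simp only [interleave, List.cons.injEq] at h
      obtain ⟨rfl, rfl, h⟩ := h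
      rw [ih h]

theorem length_interleave (l : List (Bool × Bool)) : (interleave l).length = 2 * l.length := by
  induction l with
  | nil => rfl
  | cons a l ih => simp [interleave, ih]; omega

/-- The generic word that is a witness `y` against membership of `x` in side `i` of the disjoint
pair number `j`, where `l` is the list of the
pairs `(xₘ, yₘ)`, last pair first. -/
def levelWord (j : ℕ) (i : Bool) (l : List (Bool × Bool)) : List Bool :=
  false :: (ones j ++ false :: i :: interleave l)

theorem levelWord_inj {j j' : ℕ} {i i' : Bool} {l l' : List (Bool × Bool)} :
    levelWord j i l = levelWord j' i' l' ↔ j = j' ∧ i = i' ∧ l = l' := by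
  refine ⟨fun h => ?_, by rintro ⟨rfl, rfl, rfl⟩; rfl⟩
  have h := congrArg unary (List.cons.inj h).2
  simp only [unary_ones_append, Prod.mk.injEq, Option.some.injEq, List.cons.injEq] at h
  exact ⟨h.1, h.2.1, interleave_injective h.2.2⟩

theorem length_levelWord (j : ℕ) (i : Bool) (l : List (Bool × Bool)) :
    (levelWord j i l).length = 2 * l.length + j + 3 := by
  simp [levelWord, length_interleave]; omega

theorem levelWord_mem_oracleOf {G : Set (List Bool)} {j : ℕ} {i : Bool} {l : List (Bool × Bool)} :
    levelWord j i l ∈ oracleOf G ↔ levelWord j i l ∈ G := false_cons_mem_oracleOf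

/-- `G` keeps the pair number `j` disjoint on inputs of length `n`: each input has a witness
against one of the sides. -/
def IsLegal (j n : ℕ) (G : Set (List Bool)) : Prop :=
  ∀ x : List Bool, x.length = n → ∃ i l, l.map Prod.fst = x ∧ levelWord j i l ∈ G

/-- `G` and `H` differ at most on the words of pair `j` for inputs of length `n`. -/
def AgreeOff (j n : ℕ) (G H : Set (List Bool)) : Prop :=
  ∀ w, (∀ i l, l.length = n → w ≠ levelWord j i l) → (w ∈ H ↔ w ∈ G)

/-- A set of fewer than `2ⁿ` words misses all witnesses for some input. -/
theorem exists_fresh_input {n : ℕ} (j : ℕ) {T : Finset (List Bool)} (hT : T.card < 2 ^ n) :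
    ∃ x : List Bool, x.length = n ∧ ∀ i l, l.map Prod.fst = x → levelWord j i l ∉ T := by
  by_contra! h
  choose! i l h1 h2 using h
  refine hT.not_ge (two_pow_le_card (fun x => levelWord j (i x) (l x)) h2 fun x y hx hy hxy => ?_)
  rw [← h1 x hx, ← h1 y hy, (levelWord_inj.1 hxy).2.2]

/-- A set of fewer than `2ⁿ` words misses some witness for each input. -/
theorem exists_fresh_witness {n : ℕ} (j : ℕ) (i : Bool) {T : Finset (List Bool)}
    (hT : T.card < 2 ^ n) {x : List Bool} (hx : x.length = n) :
    ∃ l, l.map Prod.fst = x ∧ levelWord j i l ∉ T := by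
  by_contra! h
  refine hT.not_ge (two_pow_le_card (fun y => levelWord j i (x.zip y)) (fun y hy => ?_)
    fun y z hy hz hyz => ?_)
  · exact h _ (List.map_fst_zip (by omega))
  · have := congrArg (List.map Prod.snd) (levelWord_inj.1 hyz).2.2
    rwa [List.map_snd_zip (by omega), List.map_snd_zip (by omega)] at this

/-! ### One step of the diagonalization -/

/-- The value at `x` computed by the program `q.1` in time `n ^ q.2 + q.2`. -/
noncomputable def polyValue (q : Program × ℕ) (V : Set (List Bool)) (x : List Bool) : List Bool :=
  (q.1.run V (fun _ => false) x (x.length ^ q.2 + q.2)).stk outputStack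

/-- Nondeterministic acceptance of `z` by the program `m.1` in time `n ^ m.2 + m.2`. -/
def PolyAccepts (m : Program × ℕ) (V : Set (List Bool)) (z : List Bool) : Prop :=
  ∃ g, m.1.Outputs V g z (z.length ^ m.2 + m.2) [true]

theorem length_polyValue_le (q : Program × ℕ) (V : Set (List Bool)) (x : List Bool) :
    (polyValue q V x).length ≤ x.length ^ q.2 + q.2 :=
  Program.length_run_stk_le (by decide) _

theorem polyValue_congr {q : Program × ℕ} {V V' : Set (List Bool)} {x : List Bool} {L : ℕ}
    (hL : x.length ^ q.2 + q.2 ≤ L) (h : ∀ w : List Bool, w.length < L → (w ∈ V' ↔ w ∈ V)) :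
    polyValue q V' x = polyValue q V x := by
  obtain ⟨S, -, hS, hS'⟩ := q.1.run_certificate V (fun _ => false) x (x.length ^ q.2 + q.2)
  rw [polyValue, hS' V' fun w hw => h w ((hS w hw).trans_le hL)]
  rfl

theorem PolyAccepts.congr {m : Program × ℕ} {V V' : Set (List Bool)} {z : List Bool} {L : ℕ}
    (hm : PolyAccepts m V z) (hL : z.length ^ m.2 + m.2 ≤ L)
    (h : ∀ w : List Bool, w.length < L → (w ∈ V' ↔ w ∈ V)) : PolyAccepts m V' z := by
  obtain ⟨g, hg⟩ := hm
  obtain ⟨S, -, hS, hS'⟩ := m.1.run_certificate V g z (z.length ^ m.2 + m.2)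
  refine ⟨g, ?_⟩
  unfold Program.Outputs
  rw [hS' V' fun w hw => h w ((hS w hw).trans_le hL)]
  exact hg

/-- A true coding word stays true as long as the answers to few basic words are kept. -/
theorem ones_mem_certificate {G : Set (List Bool)} {N : ℕ} (h : ones N ∈ oracleOf G) :
    ∃ T : Finset (List Bool), T.card ≤ 2 * N * N ∧ (∀ u ∈ T, IsBasic u ∧ u.length < N) ∧
      ∀ G', AgreeOn T (oracleOf G) (oracleOf G') → ones N ∈ oracleOf G' := by
  obtain ⟨S, hS, hS', hS''⟩ := (ones_mem_oracleOf.1 h).certificate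
  obtain ⟨T, hT, hT', hT''⟩ := basic_certificate_finset G hS hS'
  exact ⟨T, hT, hT', fun G' hG' => ones_mem_oracleOf.2 (hS'' _ (hT'' G' hG'))⟩

/-- Among the legal ways to fill a level there is one whose coding words below `L`, taken in the
order of their lengths, are lexicographically maximal. -/
theorem exists_maximal_legal (G : Set (List Bool)) (j n L : ℕ) :
    ∃ H, AgreeOff j n G H ∧ IsLegal j n H ∧ ∀ N < L, ∀ H', AgreeOff j n G H' → IsLegal j n H' →
      (∀ N' < N, (ones N' ∈ oracleOf H' ↔ ones N' ∈ oracleOf H)) →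
      ones N ∈ oracleOf H' → ones N ∈ oracleOf H := by
  induction L with
  | zero =>
    refine ⟨G ∪ {w | ∃ i l, l.length = n ∧ w = levelWord j i l}, fun w hw => ?_, fun x hx => ?_,
      by simp⟩
    · refine ⟨?_, .inl⟩
      rintro (h | ⟨i, l, hl, rfl⟩)
      · exact h
      · exact absurd rfl (hw i l hl)
    · exact ⟨true, x.map fun a => (a, true), by simp [Function.comp_def], .inr ⟨true, _, by simpa, rfl⟩⟩
  | succ L ih =>
    obtain ⟨H, hG, hH, hmax⟩ := ih
    by_cases hex : ∃ H', AgreeOff j n G H' ∧ IsLegal j n H' ∧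
        (∀ N < L, (ones N ∈ oracleOf H' ↔ ones N ∈ oracleOf H)) ∧ ones L ∈ oracleOf H'
    · obtain ⟨H₁, hG₁, hH₁, hsame, hL⟩ := hex
      refine ⟨H₁, hG₁, hH₁, fun N hN H' hG' hH' hs h => ?_⟩
      rcases Nat.lt_succ_iff_lt_or_eq.1 hN with hN | rfl
      · exact (hsame N hN).2 (hmax N hN H' hG' hH'
          (fun N' hN' => (hs N' hN').trans (hsame N' (hN'.trans hN))) h)
      · exact hL
    · refine ⟨H, hG, hH, fun N hN H' hG' hH' hs h => ?_⟩
      rcases Nat.lt_succ_iff_lt_or_eq.1 hN with hN | rfl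
      · exact hmax N hN H' hG' hH' hs h
      · exact absurd ⟨H', hG', hH', hs, h⟩ hex

/-- One step of the diagonalization against a pair given by the nondeterministic programs `M` for
the complements of its sides, and a reduction given by `q`. The sets can be made to differ from `G`
only at one arbitrarily high level, so that either the pair is not disjoint, or level `n` stays
legal and `q` fails to reduce the pair number `j` to it; and this depends only on the words shorter
than `L`. -/
theorem exists_diagonal_level (G : Set (List Bool)) (j : ℕ) (M : Bool → Program × ℕ)
    (q : Program × ℕ) (m : ℕ) :
    ∃ n ≥ m, ∃ L > n, ∃ G', AgreeOff j n G G' ∧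
      ((∀ G'', (∀ w : List Bool, w.length < L → (w ∈ G'' ↔ w ∈ G')) →
          ∃ z, ∀ i, ¬ PolyAccepts (M i) (oracleOf G'') z) ∨
        (IsLegal j n G' ∧ ∀ G'', (∀ w : List Bool, w.length < L → (w ∈ G'' ↔ w ∈ G')) →
          ∃ i x, (∀ l, l.map Prod.fst = x.reverse → levelWord j i l ∉ oracleOf G'') ∧
            PolyAccepts (M i) (oracleOf G'') (polyValue q (oracleOf G'') x))) := by
  classical
  let tf : ℕ → ℕ := fun n => n ^ q.2 + q.2
  let tm : ℕ → ℕ := fun n => (tf n ^ (M false).2 + (M false).2) + (tf n ^ (M true).2 + (M true).2)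
  let L : ℕ → ℕ := fun n => tf n + tm n + (2 * n + (j + 4))
  have htf : PolyBounded tf := (PolyBounded.id.pow _).add (.const _)
  have hL : PolyBounded fun n => 3 * L n ^ 3 :=
    (PolyBounded.const 3).mul (((htf.add (((htf.pow _).add (.const _)).add
      ((htf.pow _).add (.const _)))).add (((PolyBounded.const 2).mul .id).add (.const _))).pow 3)
  obtain ⟨n, hnm, hn⟩ := hL.exists_lt_two_pow m
  have hLn : 2 * n + j + 3 < L n := by simp only [L]; omega
  have hLf : tf n + tm n ≤ L n := by simp only [L]; omega
  have htm : ∀ i, ∀ a ≤ tf n, a ^ (M i).2 + (M i).2 ≤ tm n := by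
    intro i a ha
    have := Nat.pow_le_pow_left ha (M i).2
    cases i <;> simp only [tm] <;> omega
  generalize L n = L at *
  obtain ⟨H, hGH, hH, hmax⟩ := exists_maximal_legal G j n L
  have hcert : ∀ N, ∃ T : Finset (List Bool), T.card ≤ 2 * N * N ∧
      (∀ u ∈ T, IsBasic u ∧ u.length < N) ∧ (ones N ∈ oracleOf H →
        ∀ G', AgreeOn T (oracleOf H) (oracleOf G') → ones N ∈ oracleOf G') := by
    intro N
    by_cases h : ones N ∈ oracleOf H
    · obtain ⟨T, h1, h2, h3⟩ := ones_mem_certificate h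
      exact ⟨T, h1, h2, fun _ => h3⟩
    · exact ⟨∅, by simp, by simp, fun h' => absurd h' h⟩
  choose T hTcard hTbasic hT using hcert
  have hTall : ((Finset.range L).biUnion T).card < 2 ^ n := by
    have h1 : ((Finset.range L).biUnion T).card ≤ (Finset.range L).card * (2 * L * L) :=
      Finset.card_biUnion_le_card_mul _ _ _ fun N hN => (hTcard N).trans (by
        have := Finset.mem_range.1 hN; gcongr)
    rw [Finset.card_range] at h1
    have h2 : L * (2 * L * L) = 2 * L ^ 3 := by ring
    omega
  -- no certificate of a true coding word asks about a witness for the input `x`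
  obtain ⟨x, hx, hfresh⟩ := exists_fresh_input j hTall
  -- `H₀` is `H` without witnesses for `x`, and `K i l` has only the witness `l` against side `i`
  let H₀ : Set (List Bool) := {w | w ∈ H ∧ ∀ i l, l.map Prod.fst = x → w ≠ levelWord j i l}
  let K : Bool → List (Bool × Bool) → Set (List Bool) := fun i l => insert (levelWord j i l) H₀
  have hlen : ∀ l : List (Bool × Bool), l.map Prod.fst = x → l.length = n := fun l hl => by
    rw [← hx, ← hl, List.length_map]
  have hH₀ : ∀ w, (∀ i l, l.map Prod.fst = x → w ≠ levelWord j i l) → (w ∈ H₀ ↔ w ∈ H) :=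
    fun w hw => ⟨And.left, fun h => ⟨h, hw⟩⟩
  have hK : ∀ i l, l.map Prod.fst = x →
      ∀ w, (∀ i l, l.map Prod.fst = x → w ≠ levelWord j i l) → (w ∈ K i l ↔ w ∈ H) :=
    fun i l hl w hw => by
      rw [← hH₀ w hw]
      exact Set.mem_insert_iff.trans (or_iff_right (hw i l hl))
  have hGH₀ : AgreeOff j n G H₀ := fun w hw =>
    (hH₀ w fun i l hl => hw i l (hlen l hl)).trans (hGH w hw)
  have hGK : ∀ i l, l.map Prod.fst = x → AgreeOff j n G (K i l) := fun i l hl w hw =>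
    (hK i l hl w fun i l hl => hw i l (hlen l hl)).trans (hGH w hw)
  have hKlegal : ∀ i l, l.map Prod.fst = x → IsLegal j n (K i l) := by
    intro i l hl y hy
    by_cases hyx : y = x
    · exact ⟨i, l, hyx ▸ hl, Set.mem_insert _ _⟩
    · obtain ⟨i', l', hl', h⟩ := hH y hy
      refine ⟨i', l', hl', .inr ⟨h, fun i'' l'' hl'' he => hyx ?_⟩⟩
      rw [← hl', ← hl'', (levelWord_inj.1 he).2.2]
  -- removing witnesses for `x` does not destroy certificates
  have keep : ∀ H', (∀ w, (∀ i l, l.map Prod.fst = x → w ≠ levelWord j i l) → (w ∈ H' ↔ w ∈ H)) →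
      ∀ N < L, (∀ N' < N, (ones N' ∈ oracleOf H' ↔ ones N' ∈ oracleOf H)) →
        ones N ∈ oracleOf H → ones N ∈ oracleOf H' := by
    intro H' hH' N hN hs h
    refine hT N h H' fun u hu => ?_
    obtain ⟨⟨N', rfl⟩ | ⟨u, rfl⟩, hlt⟩ := hTbasic N u hu
    · exact hs N' (by simpa using hlt)
    · rw [false_cons_mem_oracleOf, false_cons_mem_oracleOf]
      refine hH' _ fun i l hl he => hfresh i l hl ?_
      rw [← he]
      exact Finset.mem_biUnion.2 ⟨N, Finset.mem_range.2 hN, hu⟩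
  have codeK : ∀ i l, l.map Prod.fst = x → ∀ N < L,
      (ones N ∈ oracleOf (K i l) ↔ ones N ∈ oracleOf H) := by
    intro i l hl N
    induction N using Nat.strong_induction_on with
    | _ N ih =>
      intro hN
      have hs : ∀ N' < N, (ones N' ∈ oracleOf (K i l) ↔ ones N' ∈ oracleOf H) :=
        fun N' h => ih N' h (h.trans hN)
      exact ⟨hmax N hN _ (hGK i l hl) (hKlegal i l hl) hs, keep _ (hK i l hl) N hN hs⟩
  have agree : ∀ i l, l.map Prod.fst = x → ∀ (S : Finset (List Bool)) (B : ℕ), B ≤ L →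
      (∀ u ∈ S, IsBasic u ∧ u.length < B) → levelWord j i l ∉ S →
      (∀ N < B, (ones N ∈ oracleOf H₀ ↔ ones N ∈ oracleOf H)) →
      AgreeOn S (oracleOf H₀) (oracleOf (K i l)) := by
    intro i l hl S B hB hS hlS hcode u hu
    obtain ⟨⟨N', rfl⟩ | ⟨u, rfl⟩, hlt⟩ := hS u hu
    · have hlt : N' < B := by simpa using hlt
      rw [codeK i l hl N' (hlt.trans_le hB), hcode N' hlt]
    · rw [false_cons_mem_oracleOf, false_cons_mem_oracleOf]
      exact Set.mem_insert_iff.trans (or_iff_right fun he => hlS (he ▸ hu))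
  -- a coding word that becomes true when all witnesses are removed would remain true for a
  -- suitable single witness, against the maximality of `H`
  have code₀ : ∀ N < L, (ones N ∈ oracleOf H₀ ↔ ones N ∈ oracleOf H) := by
    intro N
    induction N using Nat.strong_induction_on with
    | _ N ih =>
      intro hN
      have hs : ∀ N' < N, (ones N' ∈ oracleOf H₀ ↔ ones N' ∈ oracleOf H) :=
        fun N' h => ih N' h (h.trans hN)
      refine ⟨fun h => ?_, keep _ hH₀ N hN hs⟩
      obtain ⟨S, hS, hS', hS''⟩ := ones_mem_certificate h
      have hcard : S.card < 2 ^ n := by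
        have h1 : 2 * N * N ≤ 2 * L * L := by gcongr
        have h2 : 2 * L * L ≤ 3 * L ^ 3 := by
          have : 1 ≤ L := by omega
          calc 2 * L * L = 2 * L * L * 1 := by ring
            _ ≤ 2 * L * L * L := Nat.mul_le_mul_left _ this
            _ ≤ 3 * L ^ 3 := by ring_nf; omega
        omega
      obtain ⟨l, hl, hlS⟩ := exists_fresh_witness j true hcard hx
      exact (codeK true l hl N hN).1 (hS'' _ (agree true l hl S N hN.le hS' hlS hs))
  have hxr : x.reverse.length = n := by simpa
  have hztf : (polyValue q (oracleOf H₀) x.reverse).length ≤ tf n := by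
    have := length_polyValue_le q (oracleOf H₀) x.reverse
    rwa [hxr] at this
  refine ⟨n, hnm, L, by omega, ?_⟩
  by_cases hacc : ∃ i, PolyAccepts (M i) (oracleOf H₀) (polyValue q (oracleOf H₀) x.reverse)
  · obtain ⟨i, g, hg⟩ := hacc
    set z := polyValue q (oracleOf H₀) x.reverse with hz
    obtain ⟨S₁, h₁, h₁', h₁''⟩ := q.1.run_certificate (oracleOf H₀) (fun _ => false) x.reverse (tf n)
    obtain ⟨S₂, h₂, h₂', h₂''⟩ :=
      (M i).1.run_certificate (oracleOf H₀) g z (z.length ^ (M i).2 + (M i).2)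
    have hzt := htm i _ hztf
    obtain ⟨S, hS, hS', hS''⟩ := basic_certificate_finset H₀ (S := S₁ ∪ S₂) (m := L) (ℓ := L)
      ((Finset.card_union_le _ _).trans (by omega)) (fun w hw => by
        rcases Finset.mem_union.1 hw with hw | hw
        · have := h₁' w hw; omega
        · have := h₂' w hw; omega)
    have hcard : S.card < 2 ^ n := by
      have h2 : L * L ≤ 3 * L ^ 3 := by
        have : 1 ≤ L := by omega
        calc L * L = L * L * 1 := by ring
          _ ≤ L * L * L := Nat.mul_le_mul_left _ this
          _ ≤ 3 * L ^ 3 := by ring_nf; omega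
      omega
    obtain ⟨l, hl, hlS⟩ := exists_fresh_witness j (!i) hcard hx
    have hagree := hS'' _ (agree (!i) l hl S L le_rfl hS' hlS code₀)
    have hzK : polyValue q (oracleOf (K (!i) l)) x.reverse = z := by
      rw [hz, polyValue, polyValue, hxr]
      rw [h₁'' _ (hagree.mono Finset.subset_union_left)]
    have haccK : PolyAccepts (M i) (oracleOf (K (!i) l)) z := by
      refine ⟨g, ?_⟩
      unfold Program.Outputs
      rw [h₂'' _ (hagree.mono Finset.subset_union_right)]
      exact hg
    refine ⟨K (!i) l, hGK _ l hl, .inr ⟨hKlegal _ l hl, fun G'' hG'' => ⟨i, x.reverse, ?_, ?_⟩⟩⟩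
    · intro l' hl'
      rw [List.reverse_reverse] at hl'
      rw [levelWord_mem_oracleOf, hG'' _ (by rw [length_levelWord, hlen l' hl']; exact hLn)]
      rintro (he | he)
      · have := (levelWord_inj.1 he).2.1
        cases i <;> simp at this
      · exact he.2 i l' hl' rfl
    · have hV : ∀ w : List Bool, w.length < L → (w ∈ oracleOf G'' ↔ w ∈ oracleOf (K (!i) l)) :=
        fun w hw => oracleOf_congr hG'' hw
      rw [polyValue_congr (by rw [hxr]; change tf n ≤ L; omega) hV, hzK]
      exact haccK.congr (by omega) hV
  · push Not at hacc
    refine ⟨H₀, hGH₀, .inl fun G'' hG'' => ⟨_, fun i hi => hacc i (hi.congr (L := L) ?_ ?_)⟩⟩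
    · have := htm i _ hztf
      omega
    · exact fun w hw => (oracleOf_congr hG'' hw).symm

/-! ### The limit of the construction -/

instance : Nonempty (Bool → Program × ℕ) := ⟨fun _ => ([], 0)⟩

/-- There is a generic set such that every pair of polynomial time nondeterministic programs
accepts complements of sets that are not disjoint, or has a pair of legal levels that no polynomial
time function reduces to it. -/
theorem exists_generic :
    ∃ G : Set (List Bool), ∀ M : Bool → Program × ℕ,
      (∃ z, ∀ i, ¬ PolyAccepts (M i) (oracleOf G) z) ∨
      ∃ j, (∀ n, IsLegal j n G) ∧ ∀ q : Program × ℕ, ∃ i x,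
        (∀ l, l.map Prod.fst = x.reverse → levelWord j i l ∉ oracleOf G) ∧
          PolyAccepts (M i) (oracleOf G) (polyValue q (oracleOf G) x) := by
  obtain ⟨P, hP⟩ := exists_surjective_nat (Bool → Program × ℕ)
  obtain ⟨D, hD⟩ := exists_surjective_nat (ℕ × Program × ℕ)
  choose n hn L hL F hF hFout using fun (s : ℕ) (σ : ℕ × Set (List Bool)) =>
    exists_diagonal_level σ.2 (D s).1 (P (D s).1) (D s).2 σ.1
  -- the state consists of a length and a set that is final below this length
  let σ : ℕ → ℕ × Set (List Bool) := fun s =>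
    Nat.rec (0, Set.univ) (fun s τ => (L s τ, F s τ)) s
  have hσ : ∀ s, σ (s + 1) = (L s (σ s), F s (σ s)) := fun s => rfl
  have hlt : ∀ s, (σ s).1 < (σ (s + 1)).1 := fun s => by
    rw [hσ]
    exact (hn s (σ s)).trans_lt (hL s (σ s))
  have hmono : StrictMono fun s => (σ s).1 := strictMono_nat_of_lt_succ hlt
  have hstable : ∀ s t, s ≤ t → ∀ w : List Bool, w.length < (σ s).1 →
      (w ∈ (σ t).2 ↔ w ∈ (σ s).2) := by
    intro s t hst
    induction t, hst using Nat.le_induction with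
    | base => exact fun w _ => Iff.rfl
    | succ t hst ih =>
      intro w hw
      rw [← ih w hw, hσ]
      refine hF t (σ t) w fun i l hl he => ?_
      have h1 := congrArg List.length he
      rw [length_levelWord, hl] at h1
      have h2 := hn t (σ t)
      have h3 : (σ s).1 ≤ (σ t).1 := hmono.monotone hst
      omega
  let G : Set (List Bool) := {w | w ∈ (σ (w.length + 1)).2}
  have hG : ∀ s, ∀ w : List Bool, w.length < (σ s).1 → (w ∈ G ↔ w ∈ (σ s).2) := by
    intro s w hw
    have h1 : w.length < (σ (w.length + 1)).1 := hmono.id_le (w.length + 1)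
    rcases le_total s (w.length + 1) with h | h
    · exact hstable s _ h w hw
    · exact (hstable _ s h w h1).symm
  refine ⟨G, fun M => ?_⟩
  by_cases hdis : ∃ z, ∀ i, ¬ PolyAccepts (M i) (oracleOf G) z
  · exact .inl hdis
  obtain ⟨j, rfl⟩ := hP M
  have hwin : ∀ s, (D s).1 = j → IsLegal j (n s (σ s)) (σ (s + 1)).2 ∧ ∃ i x,
      (∀ l, l.map Prod.fst = x.reverse → levelWord j i l ∉ oracleOf G) ∧
        PolyAccepts (P j i) (oracleOf G) (polyValue (D s).2 (oracleOf G) x) := by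
    rintro s rfl
    have hGs : ∀ w : List Bool, w.length < L s (σ s) → (w ∈ G ↔ w ∈ F s (σ s)) := hG (s + 1)
    rcases hFout s (σ s) with h | ⟨h, h'⟩
    · exact absurd (h G hGs) hdis
    · exact ⟨h, h' G hGs⟩
  refine .inr ⟨j, fun m => ?_, fun q => ?_⟩
  · have hlegal : ∀ s, IsLegal j m (σ s).2 := by
      intro s
      induction s with
      | zero => exact fun x _ => ⟨true, x.map fun a => (a, true), by simp [Function.comp_def],
          Set.mem_univ _⟩
      | succ s ih =>
        by_cases hs : (D s).1 = j ∧ n s (σ s) = m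
        · exact hs.2 ▸ (hwin s hs.1).1
        · intro x hx
          obtain ⟨i, l, hl, h⟩ := ih x hx
          refine ⟨i, l, hl, ?_⟩
          rw [hσ]
          refine (hF s (σ s) _ fun i' l' hl' he => hs ?_).2 h
          obtain ⟨h1, -, rfl⟩ := levelWord_inj.1 he
          refine ⟨h1.symm, ?_⟩
          rw [← hl', ← hx, ← hl, List.length_map]
    intro x hx
    obtain ⟨i, l, hl, h⟩ := hlegal (2 * m + j + 4) x hx
    refine ⟨i, l, hl, (hG (2 * m + j + 4) _ ?_).2 h⟩
    have h1 : 2 * m + j + 4 ≤ (σ (2 * m + j + 4)).1 := hmono.id_le _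
    rw [length_levelWord, ← List.length_map (f := Prod.fst), hl, hx]
    omega
  · obtain ⟨s, hs⟩ := hD (j, q)
    have h := (hwin s (by rw [hs])).2
    rwa [hs] at h

/-! ### Programs -/

/-- The configuration `c` is at label `a` with contents `s₀`, `s₁`, `s₂` of the input stack, the
output stack and the query stack. -/
def Config.At (c : Config) (a : ℕ) (s₀ s₁ s₂ : List Bool) : Prop :=
  c.pc = a ∧ c.stk inputStack = s₀ ∧ c.stk outputStack = s₁ ∧ c.stk queryStack = s₂

section Steps

variable {p : Program} {V : Set (List Bool)} {g : ℕ → Bool} {x : List Bool} {t a : ℕ}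
  {s₀ s₁ s₂ : List Bool}

theorem run_zero_at : (p.run V g x 0).At 0 x [] [] := by
  simp [Program.run, Config.init, Config.At]

theorem at_push_output (h : (p.run V g x t).At a s₀ s₁ s₂) {b : Bool} {n : ℕ}
    (hi : p[a]? = some (.push 1 b n)) : (p.run V g x (t + 1)).At n s₀ (b :: s₁) s₂ := by
  obtain ⟨rfl, rfl, rfl, rfl⟩ := h
  rw [Program.run, Program.step_eq hi]
  simp [Instr.exec, Config.At]

theorem at_push_query (h : (p.run V g x t).At a s₀ s₁ s₂) {b : Bool} {n : ℕ}
    (hi : p[a]? = some (.push 2 b n)) : (p.run V g x (t + 1)).At n s₀ s₁ (b :: s₂) := by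
  obtain ⟨rfl, rfl, rfl, rfl⟩ := h
  rw [Program.run, Program.step_eq hi]
  simp [Instr.exec, Config.At]

theorem at_pop_input_nil (h : (p.run V g x t).At a [] s₁ s₂) {n₀ n₁ n₂ : ℕ}
    (hi : p[a]? = some (.pop 0 n₀ n₁ n₂)) : (p.run V g x (t + 1)).At n₀ [] s₁ s₂ := by
  obtain ⟨rfl, h₀, rfl, rfl⟩ := h
  rw [Program.run, Program.step_eq hi]
  simp [Instr.exec, Config.At, h₀]

theorem at_pop_input_cons {b : Bool} (h : (p.run V g x t).At a (b :: s₀) s₁ s₂) {n₀ n₁ n₂ : ℕ}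
    (hi : p[a]? = some (.pop 0 n₀ n₁ n₂)) :
    (p.run V g x (t + 1)).At (cond b n₂ n₁) s₀ s₁ s₂ := by
  obtain ⟨rfl, h₀, rfl, rfl⟩ := h
  rw [Program.run, Program.step_eq hi]
  cases b <;> simp [Instr.exec, Config.At, h₀]

theorem at_pop_output_nil (h : (p.run V g x t).At a s₀ [] s₂) {n₀ n₁ n₂ : ℕ}
    (hi : p[a]? = some (.pop 1 n₀ n₁ n₂)) : (p.run V g x (t + 1)).At n₀ s₀ [] s₂ := by
  obtain ⟨rfl, rfl, h₁, rfl⟩ := h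
  rw [Program.run, Program.step_eq hi]
  simp [Instr.exec, Config.At, h₁]

theorem at_pop_output_cons {b : Bool} (h : (p.run V g x t).At a s₀ (b :: s₁) s₂) {n₀ n₁ n₂ : ℕ}
    (hi : p[a]? = some (.pop 1 n₀ n₁ n₂)) :
    (p.run V g x (t + 1)).At (cond b n₂ n₁) s₀ s₁ s₂ := by
  obtain ⟨rfl, rfl, h₁, rfl⟩ := h
  rw [Program.run, Program.step_eq hi]
  cases b <;> simp [Instr.exec, Config.At, h₁]

theorem at_pop_query_nil (h : (p.run V g x t).At a s₀ s₁ []) {n₀ n₁ n₂ : ℕ}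
    (hi : p[a]? = some (.pop 2 n₀ n₁ n₂)) : (p.run V g x (t + 1)).At n₀ s₀ s₁ [] := by
  obtain ⟨rfl, rfl, rfl, h₂⟩ := h
  rw [Program.run, Program.step_eq hi]
  simp [Instr.exec, Config.At, h₂]

theorem at_pop_query_cons {b : Bool} (h : (p.run V g x t).At a s₀ s₁ (b :: s₂)) {n₀ n₁ n₂ : ℕ}
    (hi : p[a]? = some (.pop 2 n₀ n₁ n₂)) :
    (p.run V g x (t + 1)).At (cond b n₂ n₁) s₀ s₁ s₂ := by
  obtain ⟨rfl, rfl, rfl, h₂⟩ := h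
  rw [Program.run, Program.step_eq hi]
  cases b <;> simp [Instr.exec, Config.At, h₂]

theorem at_query_yes (h : (p.run V g x t).At a s₀ s₁ s₂) {n₀ n₁ : ℕ}
    (hi : p[a]? = some (.query n₀ n₁)) (hV : s₂ ∈ V) : (p.run V g x (t + 1)).At n₀ s₀ s₁ s₂ := by
  obtain ⟨rfl, rfl, rfl, rfl⟩ := h
  rw [Program.run, Program.step_eq hi]
  simp [Instr.exec, Config.At, hV]

theorem at_query_no (h : (p.run V g x t).At a s₀ s₁ s₂) {n₀ n₁ : ℕ}
    (hi : p[a]? = some (.query n₀ n₁)) (hV : s₂ ∉ V) : (p.run V g x (t + 1)).At n₁ s₀ s₁ s₂ := by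
  obtain ⟨rfl, rfl, rfl, rfl⟩ := h
  rw [Program.run, Program.step_eq hi]
  simp [Instr.exec, Config.At, hV]

theorem at_guess (h : (p.run V g x t).At a s₀ s₁ s₂) {n₀ n₁ : ℕ}
    (hi : p[a]? = some (.guess n₀ n₁)) :
    (p.run V g x (t + 1)).At (cond (g t) n₁ n₀) s₀ s₁ s₂ := by
  obtain ⟨rfl, rfl, rfl, rfl⟩ := h
  rw [Program.run, Program.step_eq hi]
  cases g t <;> simp [Instr.exec, Config.At]

theorem outputs_of_at (h : (p.run V g x t).At a s₀ s₁ s₂) (ha : p[a]? = none) {T : ℕ}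
    (hT : t ≤ T) : p.Outputs V g x T s₁ := by
  obtain ⟨rfl, rfl, rfl, rfl⟩ := h
  exact Program.Outputs.mono ⟨ha, rfl⟩ hT

end Steps

/-- The program fragment, starting at label `a`, that pushes `1ᵏ` and then `0` on the query stack
and goes on at label `n`. -/
def pushOnes (a k n : ℕ) : Program :=
  (List.range k).map (fun i => Instr.push 2 true (a + i + 1)) ++ [Instr.push 2 false n]

theorem length_pushOnes (a k n : ℕ) : (pushOnes a k n).length = k + 1 := by
  simp [pushOnes]

theorem at_pushOnes {p : Program} {V : Set (List Bool)} {g : ℕ → Bool} {x : List Bool} {t k n : ℕ}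
    {s₀ s₁ s₂ : List Bool} {q : Program} (hp : p = q ++ pushOnes q.length k n)
    (h : (p.run V g x t).At q.length s₀ s₁ s₂) :
    (p.run V g x (t + (k + 1))).At n s₀ s₁ (false :: (ones k ++ s₂)) := by
  have hi : ∀ i, p[q.length + i]? = (pushOnes q.length k n)[i]? := fun i => by
    rw [hp, List.getElem?_append_right (by omega)]
    simp
  have key : ∀ i ≤ k, (p.run V g x (t + i)).At (q.length + i) s₀ s₁ (ones i ++ s₂) := by
    intro i
    induction i with
    | zero => exact fun _ => by simpa using h
    | succ i ih =>
      intro hik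
      have := at_push_query (ih (by omega)) (b := true) (n := q.length + i + 1) (by
        rw [hi, pushOnes, List.getElem?_append_left (by simp; omega),
          List.getElem?_map, List.getElem?_range (by omega)]
        rfl)
      simpa [ones, List.replicate_succ, add_assoc] using this
  exact at_push_query (key k le_rfl) (by rw [hi, pushOnes, List.getElem?_append_right] <;> simp)

/-- The program that computes a function `y` of the input from the bit queries with index `k`: with
the query stack holding `1ᵐ01ᵏ0` and the reversed input, it increments `m` and asks for the next
bit until there is none. It ends at label `n`. The fragment from label `11` on, which is used for
`n = 11`, asks the oracle about `y` if this is of the form `1ᴺ`, and outputs the answer. -/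
def bitProgram (k n : ℕ) : Program :=
  [.pop 0 3 1 2, .push 2 false 0, .push 2 true 0, .push 2 false 17,
    .push 2 true 5, .query 6 8, .push 1 true 7, .push 2 true 4,
    .push 2 true 9, .query 10 n, .push 1 false 4,
    .pop 2 12 11 11, .pop 1 14 12 13, .push 2 true 12, .query 15 16, .push 1 true (18 + k),
    .push 1 false (18 + k)] ++ pushOnes 17 k 4

theorem bitProgram_isDeterministic (k n : ℕ) : (bitProgram k n).IsDeterministic := by
  intro l l'
  simp [bitProgram, pushOnes]

theorem bitProgram_halted (k n : ℕ) : (bitProgram k n)[18 + k]? = none := by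
  simp [bitProgram, length_pushOnes]
  omega

section BitProgram

variable {V : Set (List Bool)} {g : ℕ → Bool} {x y : List Bool} {k n : ℕ}

theorem bitProgram_at_reverse (w : List Bool) :
    ∀ {t : ℕ} {s₁ s₂ : List Bool}, ((bitProgram k n).run V g x t).At 0 w s₁ s₂ →
      ((bitProgram k n).run V g x (t + (2 * w.length + 1))).At 3 [] s₁ (w.reverse ++ s₂) := by
  induction w with
  | nil => exact fun h => at_pop_input_nil h rfl
  | cons b w ih =>
    intro t s₁ s₂ h
    have h1 := at_pop_input_cons h rfl
    have h2 : ((bitProgram k n).run V g x (t + 1 + 1)).At 0 w s₁ (b :: s₂) := by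
      cases b
      · exact at_push_query h1 rfl
      · exact at_push_query h1 rfl
    have h3 := ih h2
    rw [List.reverse_cons, List.append_assoc, List.singleton_append]
    convert h3 using 2
    simp only [List.length_cons]; omega

/-- The loop of `bitProgram`. -/
theorem bitProgram_at_loop {w : List Bool}
    (hy : ∀ i, ones (i + 1) ++ w ∈ V ↔ y.reverse[i / 2]? = some (i % 2 == 0)) {t : ℕ}
    (h : ((bitProgram k n).run V g x t).At 4 [] [] w) :
    ∃ t' ≤ t + (5 * y.length + 4),
      ((bitProgram k n).run V g x t').At n [] y (ones (2 * y.length + 2) ++ w) := by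
  have even : ∀ m, ones (2 * m + 1) ++ w ∈ V ↔ y.reverse[m]? = some true := fun m => by
    rw [hy, Nat.mul_div_cancel_left m (by omega)]
    simp
  have odd : ∀ m, ones (2 * m + 2) ++ w ∈ V ↔ y.reverse[m]? = some false := fun m => by
    rw [hy, show (2 * m + 1) / 2 = m by omega, show (2 * m + 1) % 2 = 1 by omega]
    simp
  have key : ∀ m ≤ y.length, ∃ t' ≤ t + 5 * m, ((bitProgram k n).run V g x t').At 4 []
      (y.reverse.take m).reverse (ones (2 * m) ++ w) := by
    intro m
    induction m with
    | zero => exact fun _ => ⟨t, by omega, by simpa using h⟩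
    | succ m ih =>
      intro hm
      obtain ⟨t', ht', h0⟩ := ih (by omega)
      have h1 : ((bitProgram k n).run V g x (t' + 1)).At 5 [] (y.reverse.take m).reverse
          (ones (2 * m + 1) ++ w) := at_push_query h0 rfl
      obtain ⟨b, hb⟩ : ∃ b, y.reverse[m]? = some b :=
        ⟨_, List.getElem?_eq_getElem (by simpa using hm)⟩
      have htake : (y.reverse.take (m + 1)).reverse = b :: (y.reverse.take m).reverse := by
        rw [List.take_add_one, hb]
        simp
      rw [htake]
      cases b with
      | true =>
        have h2 := at_query_yes h1 rfl ((even m).2 hb)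
        have h3 := at_push_output h2 rfl
        exact ⟨_, by omega, at_push_query h3 rfl⟩
      | false =>
        have h2 := at_query_no h1 rfl (by rw [even, hb]; simp)
        have h3 : ((bitProgram k n).run V g x (t' + 1 + 1 + 1)).At 9 [] (y.reverse.take m).reverse
          (ones (2 * m + 2) ++ w) := at_push_query h2 rfl
        have h4 := at_query_yes h3 rfl ((odd m).2 hb)
        exact ⟨_, by omega, at_push_output h4 rfl⟩
  obtain ⟨t', ht', h0⟩ := key y.length le_rfl
  rw [← List.length_reverse, List.take_length, List.reverse_reverse, List.length_reverse] at h0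
  have hnone : y.reverse[y.length]? = none := by simp
  have h1 : ((bitProgram k n).run V g x (t' + 1)).At 5 [] y
    (ones (2 * y.length + 1) ++ w) := at_push_query h0 rfl
  have h2 := at_query_no h1 rfl (by rw [even, hnone]; simp)
  have h3 : ((bitProgram k n).run V g x (t' + 1 + 1 + 1)).At 9 [] y
    (ones (2 * y.length + 2) ++ w) := at_push_query h2 rfl
  exact ⟨_, by omega, at_query_no h3 rfl (by rw [odd, hnone]; simp)⟩

theorem bitProgram_at_end
    (hy : ∀ i, ones (i + 1) ++ false :: (ones k ++ false :: x.reverse) ∈ V ↔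
      y.reverse[i / 2]? = some (i % 2 == 0)) :
    ∃ t ≤ 2 * x.length + k + 5 * y.length + 7, ((bitProgram k n).run V g x t).At n [] y
      (ones (2 * y.length + 2) ++ false :: (ones k ++ false :: x.reverse)) := by
  have h1 := bitProgram_at_reverse x (run_zero_at (p := bitProgram k n) (V := V) (g := g) (x := x))
  rw [List.append_nil] at h1
  have h2 := at_pushOnes rfl (at_push_query h1 (b := false) (n := 17) rfl)
  obtain ⟨t, ht, h3⟩ := bitProgram_at_loop hy h2
  exact ⟨t, by omega, h3⟩

/-- The second part of `bitProgram`, which asks the oracle about `y`. -/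
theorem bitProgram_outputs_query {b : Bool} {N : ℕ} (hb : b = true ↔ ones N ∈ V)
    (hy : ∀ i, ones (i + 1) ++ false :: (ones k ++ false :: x.reverse) ∈ V ↔
      (ones N).reverse[i / 2]? = some (i % 2 == 0)) {T : ℕ}
    (hT : 3 * x.length + 2 * k + 9 * N + 15 ≤ T) :
    (bitProgram k 11).Outputs V g x T [b] := by
  obtain ⟨t, ht, h⟩ := bitProgram_at_end (n := 11) (g := g) hy
  have clear : ∀ (s₂ : List Bool) {t : ℕ} {s₁ : List Bool},
      ((bitProgram k 11).run V g x t).At 11 [] s₁ s₂ →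
        ((bitProgram k 11).run V g x (t + (s₂.length + 1))).At 12 [] s₁ [] := by
    intro s₂
    induction s₂ with
    | nil => exact fun h => at_pop_query_nil h rfl
    | cons b s₂ ih =>
      intro t s₁ h
      have h1 : ((bitProgram k 11).run V g x (t + 1)).At 11 [] s₁ s₂ := by
        simpa using at_pop_query_cons h rfl
      convert ih h1 using 2
      simp only [List.length_cons]; omega
  have move : ∀ (m : ℕ) {t : ℕ} {s₂ : List Bool},
      ((bitProgram k 11).run V g x t).At 12 [] (ones m) s₂ →
        ((bitProgram k 11).run V g x (t + (2 * m + 1))).At 14 [] [] (ones m ++ s₂) := by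
    intro m
    induction m with
    | zero => exact fun h => at_pop_output_nil h rfl
    | succ m ih =>
      intro t s₂ h
      have h1 : ((bitProgram k 11).run V g x (t + 1)).At 13 [] (ones m) s₂ :=
        at_pop_output_cons (b := true) h rfl
      have h2 : ((bitProgram k 11).run V g x (t + 1 + 1)).At 12 [] (ones m) (true :: s₂) :=
        at_push_query h1 rfl
      have h3 : ones (m + 1) ++ s₂ = ones m ++ true :: s₂ := by
        simp [ones, List.replicate_succ']
      rw [h3]
      convert ih h2 using 2
      omega
  have h1 := clear _ h
  have h2 := move N h1
  rw [List.append_nil] at h2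
  have htime : t + ((ones (2 * (ones N).length + 2) ++
      false :: (ones k ++ false :: x.reverse)).length + 1) + (2 * N + 1) + 1 + 1 ≤ T := by
    simp at ht ⊢
    omega
  by_cases hN : ones N ∈ V
  · obtain rfl := hb.2 hN
    exact outputs_of_at (at_push_output (at_query_yes h2 rfl hN) rfl) (bitProgram_halted k 11) htime
  · obtain rfl : b = false := by simpa using mt hb.1 hN
    exact outputs_of_at (at_push_output (at_query_no h2 rfl hN) rfl) (bitProgram_halted k 11) htime

end BitProgram

/-- The program that outputs `o`, whatever the input is. -/
def constProgram (o : List Bool) : Program :=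
  o.reverse.mapIdx fun i b => Instr.push 1 b (i + 1)

theorem constProgram_outputs (o : List Bool) (V : Set (List Bool)) (g : ℕ → Bool) (x : List Bool) :
    (constProgram o).Outputs V g x o.length o := by
  have key : ∀ i ≤ o.length, ((constProgram o).run V g x i).At i x (o.reverse.take i).reverse [] := by
    intro i
    induction i with
    | zero => exact fun _ => run_zero_at
    | succ i ih =>
      intro hi
      have hi' : i < o.reverse.length := by simpa using hi
      have := at_push_output (ih (by omega)) (b := o.reverse[i]) (n := i + 1)
        (by rw [constProgram, List.getElem?_mapIdx, List.getElem?_eq_getElem hi']; rfl)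
      rwa [List.take_add_one, List.getElem?_eq_getElem hi', List.reverse_append]
  have h := key o.length le_rfl
  rw [← List.length_reverse, List.take_length, List.reverse_reverse] at h
  refine outputs_of_at h ?_ (by simp)
  simp [constProgram]

/-- The nondeterministic program that guesses, bit by bit, a witness against membership of the
input in side `i` of the pair number `j`, and asks the oracle about it. -/
def witnessProgram (j : ℕ) (i : Bool) : Program :=
  [.pop 0 6 1 2, .push 2 false 3, .push 2 true 3, .guess 4 5, .push 2 false 0, .push 2 true 0,
    .push 2 i 7, .push 2 false 10, .query 9 (11 + j), .push 1 true (11 + j)] ++ pushOnes 10 j 8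

/-- The pairs of the bits of the input and of the guesses that `witnessProgram` makes if it starts
to read `x` at time `t`. -/
def guessedPairs (g : ℕ → Bool) : ℕ → List Bool → List (Bool × Bool)
  | _, [] => []
  | t, a :: x => (a, g (t + 2)) :: guessedPairs g (t + 4) x

theorem map_fst_guessedPairs (g : ℕ → Bool) (t : ℕ) (x : List Bool) :
    (guessedPairs g t x).map Prod.fst = x := by
  induction x generalizing t with
  | nil => rfl
  | cons a x ih => simp [guessedPairs, ih]

theorem guessedPairs_congr {g g' : ℕ → Bool} {t : ℕ} (x : List Bool) (h : ∀ s ≥ t, g s = g' s) :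
    guessedPairs g t x = guessedPairs g' t x := by
  induction x generalizing t with
  | nil => rfl
  | cons a x ih =>
    rw [guessedPairs, guessedPairs, h _ (by omega), ih fun s hs => h s (by omega)]

theorem exists_guessedPairs (t : ℕ) (l : List (Bool × Bool)) :
    ∃ g, guessedPairs g t (l.map Prod.fst) = l := by
  induction l generalizing t with
  | nil => exact ⟨fun _ => false, rfl⟩
  | cons a l ih =>
    obtain ⟨g, hg⟩ := ih (t + 4)
    refine ⟨Function.update g (t + 2) a.2, ?_⟩
    rw [List.map_cons, guessedPairs, guessedPairs_congr (g' := g), hg]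
    · simp
    · exact fun s hs => Function.update_of_ne (by omega) _ _

theorem witnessProgram_at_end {V : Set (List Bool)} {g : ℕ → Bool} {x : List Bool} {j : ℕ}
    {i : Bool} (w : List Bool) : ∀ {t : ℕ} {l : List (Bool × Bool)},
      ((witnessProgram j i).run V g x t).At 0 w [] (interleave l) →
        ((witnessProgram j i).run V g x (t + (4 * w.length + 1))).At 6 [] []
          (interleave ((guessedPairs g t w).reverse ++ l)) := by
  induction w with
  | nil => exact fun h => at_pop_input_nil h rfl
  | cons a w ih =>
    intro t l h
    have h1 := at_pop_input_cons h rfl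
    have h2 : ((witnessProgram j i).run V g x (t + 1 + 1)).At 3 w [] (a :: interleave l) := by
      cases a
      · exact at_push_query h1 rfl
      · exact at_push_query h1 rfl
    have h3 := at_guess h2 rfl
    have h4 : ((witnessProgram j i).run V g x (t + 1 + 1 + 1 + 1)).At 0 w []
        (interleave ((a, g (t + 2)) :: l)) := by
      rw [interleave]
      cases hb : g (t + 2)
      · exact at_push_query (by simpa [hb] using h3) rfl
      · exact at_push_query (by simpa [hb] using h3) rfl
    rw [guessedPairs, List.reverse_cons, List.append_assoc, List.singleton_append]
    convert ih h4 using 2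
    simp only [List.length_cons]; omega

theorem witnessProgram_outputs_iff {V : Set (List Bool)} {g : ℕ → Bool} {x : List Bool} {j : ℕ}
    {i : Bool} {T : ℕ} (hT : 4 * x.length + j + 6 ≤ T) :
    (witnessProgram j i).Outputs V g x T [true] ↔
      levelWord j i (guessedPairs g 0 x).reverse ∈ V := by
  have h1 := witnessProgram_at_end (l := []) x
    (run_zero_at (p := witnessProgram j i) (V := V) (g := g) (x := x))
  rw [List.append_nil] at h1
  have h2 := at_push_query (at_push_query h1 (n := 7) (b := i) rfl) (n := 10) (b := false) rfl
  have h3 := at_pushOnes rfl h2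
  change Config.At _ 8 [] [] (levelWord j i (guessedPairs g 0 x).reverse) at h3
  have hhalt : (witnessProgram j i)[11 + j]? = none := by
    simp [witnessProgram, length_pushOnes]
    omega
  by_cases hV : levelWord j i (guessedPairs g 0 x).reverse ∈ V
  · exact iff_of_true (outputs_of_at (at_push_output (at_query_yes h3 rfl hV) rfl) hhalt
      (by omega)) hV
  · refine iff_of_false (fun h => ?_) hV
    have := h.unique (outputs_of_at (at_query_no h3 rfl hV) hhalt (by omega : _ ≤ T))
    simp at this

variable {G : Set (List Bool)}

/-! ### Disjoint pairs relative to the oracle -/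

/-- Side `i` of the pair number `j`: the inputs without witness against membership. The input is
reversed because a machine moves it bit by bit from one stack to another. -/
def witnessSide (V : Set (List Bool)) (j : ℕ) (i : Bool) : Set (List Bool) :=
  {x | ∀ l, l.map Prod.fst = x.reverse → levelWord j i l ∉ V}

theorem witnessSide_mem_CoNP (V : Set (List Bool)) (j : ℕ) (i : Bool) :
    witnessSide V j i ∈ CoNP V := by
  obtain ⟨c, hc⟩ := (((PolyBounded.const 4).mul .id).add
    (.const (j + 6))).exists_le_pow_add
  refine ⟨c, witnessProgram j i, fun x => ?_⟩
  have h := fun g => witnessProgram_outputs_iff (V := V) (g := g) (i := i) (hc x.length)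
  simp only [h]
  constructor
  · intro hx
    obtain ⟨l, hl, hlV⟩ : ∃ l, l.map Prod.fst = x.reverse ∧ levelWord j i l ∈ V := by
      by_contra! hcon
      exact hx hcon
    obtain ⟨g, hg⟩ := exists_guessedPairs 0 l.reverse
    rw [List.map_reverse, hl, List.reverse_reverse] at hg
    exact ⟨g, by rwa [hg, List.reverse_reverse]⟩
  · rintro ⟨g, hg⟩ hx
    exact hx _ (by rw [List.map_reverse, map_fst_guessedPairs]) hg

theorem disjoint_witnessSide {j : ℕ} (h : ∀ n, IsLegal j n G) :
    Disjoint (witnessSide (oracleOf G) j false) (witnessSide (oracleOf G) j true) := by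
  rw [Set.disjoint_left]
  intro x h₀ h₁
  obtain ⟨i, l, hl, hlG⟩ := h _ x.reverse rfl
  have hV := levelWord_mem_oracleOf.2 hlG
  cases i
  · exact h₀ l hl hV
  · exact h₁ l hl hV

/-- There is no complete pair if the generic set is as in `exists_generic`. -/
theorem not_exists_isCompleteDisjCoNP
    (hG : ∀ M : Bool → Program × ℕ, (∃ z, ∀ i, ¬ PolyAccepts (M i) (oracleOf G) z) ∨
      ∃ j, (∀ n, IsLegal j n G) ∧ ∀ q : Program × ℕ, ∃ i x,
        (∀ l, l.map Prod.fst = x.reverse → levelWord j i l ∉ oracleOf G) ∧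
          PolyAccepts (M i) (oracleOf G) (polyValue q (oracleOf G) x)) :
    ¬ ∃ B, IsCompleteDisjCoNP (oracleOf G) B := by
  rintro ⟨B, ⟨⟨c₀, p₀, h₀⟩, ⟨c₁, p₁, h₁⟩, hB⟩, hcomplete⟩
  have h₀ : ∀ x, x ∈ B.1ᶜ ↔ PolyAccepts (p₀, c₀) (oracleOf G) x := h₀
  have h₁ : ∀ x, x ∈ B.2ᶜ ↔ PolyAccepts (p₁, c₁) (oracleOf G) x := h₁
  rcases hG fun i => cond i (p₁, c₁) (p₀, c₀) with ⟨z, hz⟩ | ⟨j, hj, hq⟩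
  · refine Set.disjoint_left.1 hB (?_ : z ∈ B.1) ?_
    · by_contra h
      exact hz false ((h₀ z).1 h)
    · by_contra h
      exact hz true ((h₁ z).1 h)
  · obtain ⟨f, ⟨p, -, c, hf⟩, hred⟩ := hcomplete
      (witnessSide (oracleOf G) j false, witnessSide (oracleOf G) j true)
      ⟨witnessSide_mem_CoNP _ _ _, witnessSide_mem_CoNP _ _ _, disjoint_witnessSide hj⟩
    obtain ⟨i, x, hx, hacc⟩ := hq (p, c)
    rw [show polyValue (p, c) (oracleOf G) x = f x from (hf x).2] at hacc
    cases i
    · exact (h₀ (f x)).2 hacc ((hred x).1 hx)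
    · exact (h₁ (f x)).2 hacc ((hred x).2 hx)

/-! ### Deterministic and nondeterministic exponential time -/

/-- Functions bounded by `2 ^ O(n)`. -/
def ExpBounded (f : ℕ → ℕ) : Prop := ∃ c, ∀ n, f n ≤ 2 ^ (c * n + c)

namespace ExpBounded

variable {f g : ℕ → ℕ}

theorem mono (hg : ExpBounded g) (h : ∀ n, f n ≤ g n) : ExpBounded f :=
  hg.imp fun _ hd n => (h n).trans (hd n)

theorem two_pow (c : ℕ) : ExpBounded fun n => 2 ^ (c * n + c) := ⟨c, fun _ => le_rfl⟩

theorem const (c : ℕ) : ExpBounded fun _ => c :=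
  ⟨c, fun n => Nat.lt_two_pow_self.le.trans (Nat.pow_le_pow_right (by omega) (Nat.le_add_left _ _))⟩

theorem id : ExpBounded fun n => n :=
  ⟨1, fun n => Nat.lt_two_pow_self.le.trans (Nat.pow_le_pow_right (by omega) (by simp))⟩

theorem mul (hf : ExpBounded f) (hg : ExpBounded g) : ExpBounded fun n => f n * g n := by
  obtain ⟨a, ha⟩ := hf
  obtain ⟨b, hb⟩ := hg
  refine ⟨a + b, fun n => (Nat.mul_le_mul (ha n) (hb n)).trans_eq ?_⟩
  rw [← pow_add]
  ring_nf

theorem add (hf : ExpBounded f) (hg : ExpBounded g) : ExpBounded fun n => f n + g n := by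
  obtain ⟨a, ha⟩ := hf
  obtain ⟨b, hb⟩ := hg
  refine ((((two_pow a).mul (two_pow b)).mul (const 2))).mono fun n => ?_
  have h1 := ha n
  have h2 := hb n
  have h3 : 0 < 2 ^ (a * n + a) := by positivity
  have h4 : 0 < 2 ^ (b * n + b) := by positivity
  nlinarith

end ExpBounded

theorem pair_le (a b : ℕ) : Nat.pair a b ≤ (a + b + 1) ^ 2 :=
  (Nat.pair_lt_max_add_one_sq a b).le.trans (Nat.pow_le_pow_left (by omega) 2)

theorem acceptNum_expBounded (e c : ℕ) : ∃ B, ExpBounded B ∧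
    ∀ x : List Bool, acceptNum e (2 ^ (c * x.length + c)) x ≤ B x.length := by
  have sq : ∀ {f : ℕ → ℕ}, ExpBounded f → ExpBounded fun n => f n ^ 2 := fun hf => by
    simpa only [sq] using hf.mul hf
  refine ⟨_, sq (((ExpBounded.const 0).add (sq (((ExpBounded.const e).add (sq (((ExpBounded.two_pow
    c).add (.two_pow 1)).add (.const 1)))).add (.const 1)))).add (.const 1)), fun x => ?_⟩
  refine (pair_le _ _).trans ?_
  gcongr
  refine (pair_le _ _).trans ?_
  gcongr
  refine (pair_le _ _).trans ?_
  gcongr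
  simpa using (wordNum_lt x).le

theorem E_subset_NE (V : Set (List Bool)) : E V ⊆ NE V := by
  rintro A ⟨c, p, hp, h⟩
  refine ⟨c, p, fun x => ?_⟩
  obtain ⟨b, hb, hout⟩ := h x
  rw [← hb]
  constructor
  · rintro rfl
    exact ⟨_, hout⟩
  · rintro ⟨g, hg⟩
    unfold Program.Outputs at hg
    rw [Program.run_eq_of_isDeterministic (g' := fun _ => false) hp] at hg
    have := Program.Outputs.unique (p := p) hout hg
    simpa using this

/-- A nondeterministic machine of exponential time is decided by asking one coding word of
exponential length. -/
theorem NE_subset_E : NE (oracleOf G) ⊆ E (oracleOf G) := by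
  classical
  rintro A ⟨c, p, h⟩
  obtain ⟨e, rfl⟩ := prog_surjective p
  obtain ⟨B, hB, hle⟩ := acceptNum_expBounded e c
  let k := Nat.pair 2 (Nat.pair e c)
  have hT : ExpBounded fun n => 3 * n + 2 * k + 9 * B n + 15 :=
    ((((ExpBounded.const 3).mul .id).add (.const (2 * k))).add
      ((ExpBounded.const 9).mul hB)).add (.const 15)
  obtain ⟨c', hc'⟩ := hT
  refine ⟨c', bitProgram k 11, bitProgram_isDeterministic k 11, fun x => ?_⟩
  let N := acceptNum e (2 ^ (c * x.length + c)) x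
  refine ⟨decide (ones N ∈ oracleOf G), ?_, ?_⟩
  · rw [decide_eq_true_iff, ones_mem_oracleOf, h x]
    simp [CodeTrue, N, acceptNum, numWord_wordNum]
  · refine bitProgram_outputs_query (N := N) (by simp) (fun i => ?_) (le_trans ?_ (hc' x.length))
    · rw [bit_mem_oracleOf]
      simp [bitFun, k, N]
    · have := hle x
      simp only [N]
      omega

/-! ### The p-optimal proof system -/

/-- The functions `bitFun` with outputs of polynomial length can be computed in polynomial time. -/
theorem bitFun_mem_FP {k : ℕ} {B : ℕ → ℕ} (hB : PolyBounded B)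
    (h : ∀ x, (bitFun (oracleOf G) k x).length ≤ B x.length) :
    bitFun (oracleOf G) k ∈ FP (oracleOf G) := by
  obtain ⟨c, hc⟩ := ((((PolyBounded.const 2).mul .id).add (.const k)).add
    ((PolyBounded.const 5).mul hB) |>.add (.const 7)).exists_le_pow_add
  refine ⟨bitProgram k (18 + k), bitProgram_isDeterministic _ _, c, fun x => ?_⟩
  obtain ⟨t, ht, hat⟩ := bitProgram_at_end (V := oracleOf G) (g := fun _ => false)
    (n := 18 + k) (x := x) (k := k) (y := bitFun (oracleOf G) k x) fun i => by
      rw [bit_mem_oracleOf, List.reverse_reverse]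
  refine outputs_of_at hat (bitProgram_halted _ _) (le_trans ?_ (hc x.length))
  have := h x
  omega

theorem proofSystem_mem_FP : proofSystem (oracleOf G) ∈ FP (oracleOf G) := by
  have h : proofSystem (oracleOf G) = bitFun (oracleOf G) (Nat.pair 0 0) := by
    ext x : 1
    simp [bitFun]
  rw [h]
  refine bitFun_mem_FP (PolyBounded.id.add (.const 3)) fun x => ?_
  rw [← h]
  unfold proofSystem
  split
  · rename_i M π hx
    have hlen := length_unary hx
    simp only
    split_ifs with hM
    · have h1 := sq_time_le hM.1
      have h2 := Program.length_run_stk_le (p := prog M.unpair.2.unpair.1) (V := oracleOf G)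
        (g := fun _ => false) (x := π) (k := outputStack) (by decide) M.unpair.2.unpair.2
      omega
    · simp [Formula.encode]
  · simp [Formula.encode]

/-- The value of the proof system at the proof that contains a computation of a sound program. -/
theorem proofSystem_ones_unsoundNum {e T : ℕ} {π o : List Bool}
    (hout : (prog e).Outputs (oracleOf G) (fun _ => false) π T o)
    (hsound : ∀ x o', (prog e).Outputs (oracleOf G) (fun _ => false) x T o' →
      o' ∈ TAUT (oracleOf G)) :
    proofSystem (oracleOf G) (ones (unsoundNum e T) ++ false :: π) = o := by
  have h : ones (unsoundNum e T) ∉ oracleOf G := by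
    rw [ones_mem_oracleOf]
    simp only [CodeTrue, unsoundNum, Nat.unpair_pair, one_ne_zero, if_false]
    rintro ⟨x, o', h1, h2⟩
    exact h2 (hsound x o' h1)
  unfold proofSystem
  simp only [unary_ones_append]
  rw [if_pos]
  · simpa [unsoundNum] using hout.2
  · exact ⟨by simp [unsoundNum], h, by simpa [unsoundNum] using hout.1⟩

theorem range_proofSystem : Set.range (proofSystem (oracleOf G)) = TAUT (oracleOf G) := by
  have htrue : (Formula.const true).encode ∈ TAUT (oracleOf G) :=
    ⟨_, rfl, fun v => by simp [Formula.eval]⟩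
  ext o
  constructor
  · rintro ⟨w, rfl⟩
    unfold proofSystem
    split
    · rename_i M π hx
      simp only
      split_ifs with hM
      · by_contra ho
        refine hM.2.1 (ones_mem_oracleOf.2 ?_)
        rw [CodeTrue, if_neg hM.1]
        exact ⟨π, _, ⟨hM.2.2, rfl⟩, ho⟩
      · exact htrue
    · exact htrue
  · intro ho
    -- `o` is proved by the program that always outputs `o`
    obtain ⟨e, he⟩ := prog_surjective (constProgram o)
    have hout := fun x => constProgram_outputs o (oracleOf G) (fun _ => false) x
    rw [← he] at hout
    refine ⟨ones (unsoundNum e o.length) ++ false :: [],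
      proofSystem_ones_unsoundNum (hout []) fun x o' h => ?_⟩
    rwa [← (hout x).unique h]

theorem isPOptimal_proofSystem :
    IsPOptimal (oracleOf G) (TAUT (oracleOf G)) (proofSystem (oracleOf G)) := by
  refine ⟨⟨proofSystem_mem_FP, range_proofSystem⟩, ?_⟩
  rintro Q ⟨⟨q, -, c, hQ⟩, hrange⟩
  obtain ⟨e, rfl⟩ := prog_surjective q
  have hf : ∀ x, bitFun (oracleOf G) (Nat.pair 1 (Nat.pair e c)) x =
      ones (unsoundNum e (x.length ^ c + c)) ++ false :: x := fun x => by simp [bitFun]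
  refine ⟨bitFun (oracleOf G) (Nat.pair 1 (Nat.pair e c)), ?_, fun x => ?_⟩
  · have hB : PolyBounded fun n =>
        (1 + (e + (n ^ c + c) + 1) ^ 2 + 1) ^ 2 + (n + 1) :=
      ((((PolyBounded.const 1).add ((((PolyBounded.const e).add ((PolyBounded.id.pow c).add
        (.const c))).add (.const 1)).pow 2)).add (.const 1)).pow 2).add
          (PolyBounded.id.add (.const 1))
    refine bitFun_mem_FP hB fun x => ?_
    rw [hf]
    simp only [List.length_append, List.length_replicate, List.length_cons]
    gcongr
    refine (pair_le _ _).trans ?_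
    gcongr
    exact pair_le _ _
  · rw [hf]
    refine proofSystem_ones_unsoundNum (hQ x) fun y o h => ?_
    rw [← hrange]
    exact ⟨y, (hQ y).unique h⟩

end OracleWorld

theorem theorem5p1 :
    ∃ V : Set (List Bool),
      (¬ ∃ B : Set (List Bool) × Set (List Bool), OracleWorld.IsCompleteDisjCoNP V B) ∧
      OracleWorld.E V = OracleWorld.NE V ∧
      ∃ P : List Bool → List Bool, OracleWorld.IsPOptimal V (OracleWorld.TAUT V) P := by
  obtain ⟨G, hG⟩ := OracleWorld.exists_generic
  exact ⟨OracleWorld.oracleOf G, OracleWorld.not_exists_isCompleteDisjCoNP hG,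
    (OracleWorld.E_subset_NE _).antisymm OracleWorld.NE_subset_E, _,
    OracleWorld.isPOptimal_proofSystem⟩
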